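/- Let $\mathbb F$ be a finite field. An algebra is an $\mathbb F$-vector space $P$ with a bilinear product (not necessarily associative or unital); $P^i$ denotes the linear span of all products of $i$ elements of $P$ with any placement of brackets, and $I(P)=\{x\in P: xa=ax=0 \text{ for all } a\in P\}$ is the annihilator. A primitive class $\mathfrak V$ is the class of all algebras satisfying a given set of polynomial identities (nonassociative polynomials without constant term in countably many variables); $F_n(\mathfrak V)$ is its relatively free algebra of rank $n$. Let $c\ge 2$. The class $\mathfrak V$ is called $c$-step nilpotent if $P^{c+1}=0$ for all $P\in\mathfrak V$ and $P^c\neq 0$ for some $P\in\mathfrak V$; it is then called central if $I(F_n(\mathfrak V))=F_n(\mathfrak V)^c$ for all $n\ge 2$. **Theorem.** Let $\mathfrak V$ be a central $c$-step nilpotent primitive class of algebras over $\mathbb F$, $c\ge 2$. For each $n$ let $\mathfrak V_n$ be the set of isomorphism classes of algebras in $\mathfrak V$ that can be generated by $n$ elements, and let $T_n\subseteq\mathfrak V_n$ be the set of classes of those $P$ such that every automorphism $\delta$ of $P$ is scalar modulo $P^2$, i.e. there is $\lambda\in\mathbb F$ with $\delta(a)-\lambda a\in P^2$ for all $a\in P$.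 Then all the sets $\mathfrak V_n$ are finite, and the property of belonging to $T_n$ is generic: $$\frac{|T_n|}{|\mathfrak V_n|}\longrightarrow 1\qquad (n\to\infty).$$ Moreover, the algebras admitting an automorphism that is not scalar modulo $P^2$ are exponentially negligible: there is a real number $r$ with $0\le r<1$ such that $$\frac{|T_n|}{|\mathfrak V_n|}>1-r^n\quad\text{for all sufficiently large } n.$$ -/

import Mathlib

open Filter Topology

noncomputable section

namespace NilpAlg

universe u v

section Basic

variable (F : Type u) [Field F] (P : Type v) [NonUnitalNonAssocRing P] [Module F P]

/-- The power `P^i` of a (nonassociative, nonunital) algebra `P`: the linear span of the values in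
`P` of all nonassociative monomials of degree `i`, i.e. of all products of `i` elements of `P`
with an arbitrary placement of brackets. -/
def power (i : ℕ) : Submodule F P :=
  Submodule.span F {x | ∃ m : FreeMagma P, m.length = i ∧ FreeMagma.lift id m = x}

variable [IsScalarTower F P P] [SMulCommClass F P P]

/-- The annihilator `I(P) = {x | ∀ a, a x = x a = 0}`. -/
def annihilator : Submodule F P where
  carrier := {x | ∀ a : P, a * x = 0 ∧ x * a = 0}
  zero_mem' := by simp
  add_mem' := by
    intro x y hx hy a
    simp [mul_add, add_mul, (hx a).1, (hx a).2, (hy a).1, (hy a).2]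
  smul_mem' := by
    intro r x hx a
    simp [mul_smul_comm, smul_mul_assoc, (hx a).1, (hx a).2]

/-- The identities `w = 0`, `w ∈ V`, all hold in `P`. Thus `P` belongs to the primitive class
defined by the set `V` of nonassociative polynomials in countably many variables. -/
def InClass (V : Set (FreeNonUnitalNonAssocAlgebra F ℕ)) : Prop :=
  ∀ w ∈ V, ∀ a : ℕ → P, FreeNonUnitalNonAssocAlgebra.lift F a w = 0

/-- `P` is generated, as an algebra, by `n` elements (not necessarily distinct). -/
def IsGeneratedBy (n : ℕ) : Prop :=
  ∃ a : Fin n → P, NonUnitalAlgebra.adjoin F (Set.range a) = ⊤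

variable {P}

/-- An endomorphism `δ` of `P` is scalar modulo `P^2`. -/
def IsScalarModSquare (δ : P →ₙₐ[F] P) : Prop :=
  ∃ r : F, ∀ a : P, δ a - r • a ∈ power F P 2

end Basic

section Quotients

variable (F : Type u) [Field F] (P : Type v) [NonUnitalNonAssocRing P] [Module F P]

/-- A two-sided ideal of an `F`-algebra: a subspace stable under multiplication on both sides. -/
structure AlgIdeal where
  toSubmodule : Submodule F P
  mul_mem_left : ∀ (a : P) {x : P}, x ∈ toSubmodule → a * x ∈ toSubmodule
  mul_mem_right : ∀ (a : P) {x : P}, x ∈ toSubmodule → x * a ∈ toSubmodule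

variable {F P}

/-- The quotient algebra `P / K`. -/
def AlgIdeal.Quot (K : AlgIdeal F P) : Type v := P ⧸ K.toSubmodule

namespace AlgIdeal

variable (K : AlgIdeal F P)

instance : AddCommGroup K.Quot := inferInstanceAs (AddCommGroup (P ⧸ K.toSubmodule))

instance : Module F K.Quot := inferInstanceAs (Module F (P ⧸ K.toSubmodule))

/-- The canonical projection `P → P / K`. -/
def proj : P →ₗ[F] K.Quot := K.toSubmodule.mkQ

theorem proj_surjective : Function.Surjective K.proj := K.toSubmodule.mkQ_surjective

theorem proj_eq_proj {x y : P} : K.proj x = K.proj y ↔ x - y ∈ K.toSubmodule :=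
  Submodule.Quotient.eq K.toSubmodule

instance : Mul K.Quot where
  mul := Quotient.map₂ (fun x y : P => x * y) (by
    intro x x' hx y y' hy
    replace hx := (Submodule.quotientRel_def K.toSubmodule).mp hx
    replace hy := (Submodule.quotientRel_def K.toSubmodule).mp hy
    refine (Submodule.quotientRel_def K.toSubmodule).mpr ?_
    have h : x * y - x' * y' = (x - x') * y + x' * (y - y') := by
      rw [sub_mul, mul_sub]; abel
    rw [h]
    exact add_mem (K.mul_mem_right _ hx) (K.mul_mem_left _ hy))

theorem proj_mul (x y : P) : K.proj (x * y) = K.proj x * K.proj y := rfl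

instance : NonUnitalNonAssocRing K.Quot where
  left_distrib := by
    intro a b c
    obtain ⟨a, rfl⟩ := K.proj_surjective a
    obtain ⟨b, rfl⟩ := K.proj_surjective b
    obtain ⟨c, rfl⟩ := K.proj_surjective c
    simp only [← map_add, ← proj_mul, mul_add]
  right_distrib := by
    intro a b c
    obtain ⟨a, rfl⟩ := K.proj_surjective a
    obtain ⟨b, rfl⟩ := K.proj_surjective b
    obtain ⟨c, rfl⟩ := K.proj_surjective c
    simp only [← map_add, ← proj_mul, add_mul]
  zero_mul := by
    intro a
    obtain ⟨a, rfl⟩ := K.proj_surjective a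
    rw [← map_zero K.proj, ← proj_mul, zero_mul]
  mul_zero := by
    intro a
    obtain ⟨a, rfl⟩ := K.proj_surjective a
    rw [← map_zero K.proj, ← proj_mul, mul_zero]

instance [IsScalarTower F P P] : IsScalarTower F K.Quot K.Quot where
  smul_assoc := by
    intro r a b
    obtain ⟨a, rfl⟩ := K.proj_surjective a
    obtain ⟨b, rfl⟩ := K.proj_surjective b
    simp only [smul_eq_mul, ← map_smul, ← proj_mul, smul_mul_assoc]

instance [SMulCommClass F P P] : SMulCommClass F K.Quot K.Quot where
  smul_comm := by
    intro r a b
    obtain ⟨a, rfl⟩ := K.proj_surjective a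
    obtain ⟨b, rfl⟩ := K.proj_surjective b
    simp only [smul_eq_mul, ← map_smul, ← proj_mul, mul_smul_comm]

end AlgIdeal

end Quotients

section RelativelyFree

variable {F : Type u} [Field F] (V : Set (FreeNonUnitalNonAssocAlgebra F ℕ))
variable (P : Type v) [NonUnitalNonAssocRing P] [Module F P] [IsScalarTower F P P]
  [SMulCommClass F P P]

/-- Membership in the ideal of `P` generated by all values `w(a₁, a₂, …)`, with `w ∈ V` and
`aᵢ ∈ P`. -/
inductive VerbalMem : P → Prop
  | value (w : FreeNonUnitalNonAssocAlgebra F ℕ) (hw : w ∈ V) (a : ℕ → P) :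
      VerbalMem (FreeNonUnitalNonAssocAlgebra.lift F a w)
  | zero : VerbalMem 0
  | add (x y : P) : VerbalMem x → VerbalMem y → VerbalMem (x + y)
  | smul (r : F) (x : P) : VerbalMem x → VerbalMem (r • x)
  | mul_left (a x : P) : VerbalMem x → VerbalMem (a * x)
  | mul_right (a x : P) : VerbalMem x → VerbalMem (x * a)

/-- The verbal ideal `V(P)`. -/
def verbalIdeal : AlgIdeal F P where
  toSubmodule :=
    { carrier := {x | VerbalMem V P x}
      zero_mem' := VerbalMem.zero
      add_mem' := fun hx hy => VerbalMem.add _ _ hx hy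
      smul_mem' := fun r _ hx => VerbalMem.smul r _ hx }
  mul_mem_left := fun a _ hx => VerbalMem.mul_left a _ hx
  mul_mem_right := fun a _ hx => VerbalMem.mul_right a _ hx

/-- The relatively free algebra `F_n(𝔙)` of rank `n` in the primitive class `𝔙` defined by `V`:
the quotient of the absolutely free algebra on `n` generators by its verbal ideal. -/
abbrev RelFree (n : ℕ) : Type u :=
  (verbalIdeal V (FreeNonUnitalNonAssocAlgebra F (Fin n))).Quot

end RelativelyFree

section Classes

variable (F : Type u) [Field F]

/-- A nonassociative nonunital algebra over `F`. -/
structure Alg : Type (u + 1) where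
  carrier : Type u
  [ring : NonUnitalNonAssocRing carrier]
  [module : Module F carrier]
  [tower : IsScalarTower F carrier carrier]
  [comm : SMulCommClass F carrier carrier]

attribute [instance] Alg.ring Alg.module Alg.tower Alg.comm

variable {F}

/-- Isomorphism of `F`-algebras. -/
def Alg.Iso (A B : Alg F) : Prop :=
  ∃ f : A.carrier →ₙₐ[F] B.carrier, Function.Bijective f

variable (V : Set (FreeNonUnitalNonAssocAlgebra F ℕ))

/-- The primitive class defined by `V` is `c`-step nilpotent: `P^{c+1} = 0` for all its members
`P`, while `P^c ≠ 0` for some of them. -/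
def IsStepNilpotent (c : ℕ) : Prop :=
  (∀ A : Alg F, InClass F A.carrier V → power F A.carrier (c + 1) = ⊥) ∧
    ∃ A : Alg F, InClass F A.carrier V ∧ power F A.carrier c ≠ ⊥

/-- The `c`-step nilpotent primitive class defined by `V` is central: `I(F_n) = F_n^c` for the
relatively free algebras `F_n` of all ranks `n ≥ 2`. -/
def IsCentral (c : ℕ) : Prop :=
  ∀ n : ℕ, 2 ≤ n → annihilator F (RelFree V n) = power F (RelFree V n) c

/-- The `n`-generated algebras of the primitive class defined by `V`. -/
def GenAlg (n : ℕ) : Type (u + 1) :=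
  {A : Alg F // InClass F A.carrier V ∧ IsGeneratedBy F A.carrier n}

/-- Isomorphism, as an equivalence relation on `n`-generated algebras of the class. -/
instance genSetoid (n : ℕ) : Setoid (GenAlg V n) where
  r A B := A.1.Iso B.1
  iseqv :=
    { refl := fun A => ⟨NonUnitalAlgHom.id F A.1.carrier, Function.bijective_id⟩
      symm := by
        rintro A B ⟨f, hf⟩
        obtain ⟨g, hl, hr⟩ := Function.bijective_iff_has_inverse.mp hf
        exact ⟨NonUnitalAlgHom.inverse f g hl hr,
          Function.bijective_iff_has_inverse.mpr ⟨f, hr, hl⟩⟩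
      trans := by
        rintro A B C ⟨f, hf⟩ ⟨g, hg⟩
        exact ⟨g.comp f, hg.comp hf⟩ }

/-- The set `𝔙_n` of isomorphism classes of `n`-generated algebras of the class. -/
def IsoClasses (n : ℕ) : Type (u + 1) := Quotient (genSetoid V n)

/-- The isomorphism classes of those `n`-generated algebras `P` of the class all of whose
automorphisms are scalar modulo `P^2`. -/
def scalarClasses (n : ℕ) : Set (IsoClasses V n) :=
  {x | ∀ A : GenAlg V n, Quotient.mk (genSetoid V n) A = x →
    ∀ δ : A.1.carrier →ₙₐ[F] A.1.carrier, Function.Bijective δ → IsScalarModSquare F δ}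

/-- The isomorphism classes of those `n`-generated algebras `P` of the class which admit an
automorphism that is not scalar modulo `P^2`. -/
def nonScalarClasses (n : ℕ) : Set (IsoClasses V n) :=
  {x | ∃ A : GenAlg V n, Quotient.mk (genSetoid V n) A = x ∧
    ∃ δ : A.1.carrier →ₙₐ[F] A.1.carrier, Function.Bijective δ ∧ ¬ IsScalarModSquare F δ}

end Classes

section Generic

/-- For a sequence of finite sets `S n` (regarded as pairwise disjoint) with subsets `T n`: the
elements of the `T n` are generic, i.e. `|T n| / |S n| → 1`. -/
def IsGeneric (S : ℕ → Type v) (T : ∀ n, Set (S n)) : Prop :=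
  (∀ n, Finite (S n)) ∧
    Tendsto (fun n => (Nat.card (T n) : ℝ) / (Nat.card (S n) : ℝ)) atTop (𝓝 1)

/-- For a sequence of finite sets `S n` with subsets `N n`, whose complements are `T n`: the `N n`
are exponentially negligible, i.e. `|T n| / |S n| → 1` faster than `1 - r ^ n` for some
`0 ≤ r < 1`. -/
def IsExpNegligible (S : ℕ → Type v) (N : ∀ n, Set (S n)) : Prop :=
  (∀ n, Finite (S n)) ∧ ∃ r : ℝ, 0 ≤ r ∧ r < 1 ∧
    ∀ᶠ n in atTop, 1 - r ^ n < (Nat.card ((N n)ᶜ : Set (S n)) : ℝ) / (Nat.card (S n) : ℝ)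

end Generic

end NilpAlg

end

namespace NilpAlg

/-! ### Counting subspaces and invariant subspaces over a finite field -/

section Counting

open Module

variable {F X : Type*} [Field F] [AddCommGroup X] [Module F X] [Finite X]

/-! Let R be the relatively free algebra of rank n, C = R^c, D = dim C and q = |F|. The n-generated
algebras of the class are the quotients R/K by ideals K, so the theorem is a count of ideals on the
scale q^(D²/4), the approximate number of subspaces of C.

Many classes: R^(c+1) = 0, so every subspace of C is an ideal. An isomorphism of two quotients lifts
to an endomorphism of R, and on C this endomorphism depends only on its linear part, one of q^(n²)
matrices (`hom_eq_on_power`). Hence there are at least about q^(D²/4 - n²) classes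
(`card_submodule_le_card_isoClasses`). For n ≥ 2c one has D ≥ n(n-1)/2 (`choose_le_finrank`,
`choose_two_le_choose`), so n² costs only about 2D in the exponent, and it suffices to save larger
multiples of D on the exceptional ideals.

Ideals not contained in C (`ncard_ideals_not_le`): here centrality is decisive. If K has image of
dimension l in R/C, the products of K with R span a space of dimension at least about nl/(2c)
(`expansion`). This space depends only on the image, so K is confined to a short interval of
subspaces.

Ideals inside C with a nonscalar automorphism (`exists_of_mem_nonScalarClasses`): such a K is
invariant under a nonscalar linear substitution T of C. If all eigenspaces of T have dimension at
most D/4, most vectors k force an independent Tk into K, which roughly halves the freedom in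
choosing K. If an eigenspace for r is larger, T - r still has rank at least n - c
(`sub_le_finrank_range`), and K is determined by its image under T - r and a choice modulo ker(T -
r). Either way the saving exceeds the factor q^(n²) for the choice of the substitution
(`ncard_subst_invariant_le`). Altogether the exceptional proportion is below 2^(-n) once n ≥ 83c. -/

theorem ncard_submodule (Z : Submodule F X) :
    (Z : Set X).ncard = Nat.card F ^ finrank F Z := by
  rw [← Module.natCard_eq_pow_finrank]; rfl

/-- Graphs of linear maps give many subspaces. -/
theorem pow_le_card_submodule :
    Nat.card F ^ ((finrank F X / 2) * (finrank F X - finrank F X / 2)) ≤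
      Nat.card (Submodule F X) := by
  set m := finrank F X with hm
  have e : ((Fin (m / 2) → F) × (Fin (m - m / 2) → F)) ≃ₗ[F] X :=
    LinearEquiv.ofFinrankEq _ _ (by rw [finrank_prod, finrank_fin_fun, finrank_fin_fun]; omega)
  have h1 : Nat.card ((Fin (m / 2) → F) →ₗ[F] (Fin (m - m / 2) → F)) =
      Nat.card F ^ ((m / 2) * (m - m / 2)) := by
    rw [Module.natCard_eq_pow_finrank (K := F), finrank_linearMap, finrank_fin_fun,
      finrank_fin_fun]
  rw [← h1]
  refine Nat.card_le_card_of_injective (fun f => f.graph.map (e : _ →ₗ[F] X)) ?_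
  intro f g h
  have h2 : f.graph = g.graph := Submodule.map_injective_of_injective e.injective h
  ext1 x
  ext1
  have : (Pi.single x 1, f (Pi.single x 1)) ∈ g.graph := by
    rw [← h2]; simp [LinearMap.mem_graph_iff]
  rw [LinearMap.mem_graph_iff] at this
  simpa using this

theorem finrank_comap_le (N : X →ₗ[F] X) (Z : Submodule F X) :
    finrank F (Z.comap N) ≤ finrank F Z + finrank F (LinearMap.ker N) := by
  let N' := N.domRestrict (Z.comap N)
  have h2 := LinearMap.finrank_range_add_finrank_ker N'
  have h3 : finrank F (LinearMap.range N') ≤ finrank F Z := by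
    refine Submodule.finrank_mono ?_
    rintro _ ⟨x, rfl⟩
    exact x.2
  have h4 : finrank F (LinearMap.ker N') ≤ finrank F (LinearMap.ker N) := by
    refine LinearMap.finrank_le_finrank_of_injective
      (f := (((Z.comap N).subtype).restrict (p := LinearMap.ker N') (q := LinearMap.ker N)
        (fun x hx => by simpa [N'] using hx))) ?_
    intro x y hxy
    have := congrArg Subtype.val hxy
    simpa using this
  omega

variable [Finite F]

theorem two_le_card_field (F : Type*) [Field F] [Finite F] : 2 ≤ Nat.card F :=
  Finite.one_lt_card

/-- Double counting of pairs `k ∈ K`, with `k` outside a small bad set. -/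
theorem ncard_supers_mul_le {𝒦 : Set (Submodule F X)} {d : ℕ}
    (h𝒦 : ∀ K ∈ 𝒦, finrank F K = d) (hd : 1 ≤ d) {Z : Submodule F X} {bad : Set X}
    (hbad : bad.ncard ≤ Nat.card F ^ (d - 1)) {W : X → Submodule F X}
    (hW : ∀ K ∈ 𝒦, Z ≤ K → ∀ k ∈ K, W k ≤ K) {B : ℕ}
    (hB : ∀ k ∉ bad, {K | K ∈ 𝒦 ∧ W k ≤ K}.ncard ≤ B) :
    {K | K ∈ 𝒦 ∧ Z ≤ K}.ncard * Nat.card F ^ (d - 1) ≤ Nat.card F ^ finrank F X * B := by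
  classical
  have := Fintype.ofFinite X
  have := Fintype.ofFinite (Submodule F X)
  have key := Finset.card_mul_le_card_mul (fun (K : Submodule F X) (k : X) => k ∈ K)
    (s := {K | K ∈ 𝒦 ∧ Z ≤ K}.toFinset) (t := badᶜ.toFinset)
    (m := Nat.card F ^ (d - 1)) (n := B) ?_ ?_
  · rw [Set.ncard_eq_toFinset_card']
    refine key.trans (Nat.mul_le_mul_right _ ?_)
    rw [← Module.natCard_eq_pow_finrank, Nat.card_eq_fintype_card]
    exact Finset.card_le_univ _
  · intro K hK
    simp only [Set.mem_toFinset, Set.mem_ofPred_eq] at hK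
    have h1 : Finset.bipartiteAbove (fun (K : Submodule F X) (k : X) => k ∈ K)
        badᶜ.toFinset K = ((K : Set X) \ bad).toFinset := by
      ext k; simp [Finset.mem_bipartiteAbove, and_comm]
    rw [h1, ← Set.ncard_eq_toFinset_card']
    have h2 := Set.le_ncard_sdiff bad (K : Set X)
    rw [ncard_submodule, h𝒦 K hK.1] at h2
    -- Since q ≥ 2, removing at most q^(d-1) bad vectors from K leaves at least q^(d-1) good ones.
    have h3 : 2 * Nat.card F ^ (d - 1) ≤ Nat.card F ^ d := by
      obtain ⟨e, rfl⟩ := Nat.exists_eq_add_of_le' hd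
      rw [Nat.add_sub_cancel, pow_succ, mul_comm]
      exact Nat.mul_le_mul_left _ (two_le_card_field F)
    omega
  · intro k hk
    simp only [Set.mem_toFinset, Set.mem_compl_iff] at hk
    refine le_trans ?_ (hB k hk)
    rw [← Set.ncard_coe_finset]
    by_cases hk' : ∃ K, K ∈ 𝒦 ∧ Z ≤ K ∧ k ∈ K
    · refine Set.ncard_le_ncard ?_
      intro K hK
      simp only [Finset.coe_bipartiteBelow, Set.mem_ofPred_eq, Set.mem_toFinset] at hK
      exact ⟨hK.1.1, hW K hK.1.1 hK.1.2 k hK.2⟩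
    · have : ((Finset.bipartiteBelow (fun (K : Submodule F X) (k : X) => k ∈ K)
          {K | K ∈ 𝒦 ∧ Z ≤ K}.toFinset k : Finset _) : Set (Submodule F X)) = ∅ := by
        rw [Set.eq_empty_iff_forall_notMem]
        intro K hK
        simp only [Finset.coe_bipartiteBelow, Set.mem_ofPred_eq, Set.mem_toFinset] at hK
        exact hk' ⟨K, hK.1.1, hK.1.2, hK.2⟩
      rw [this]; simp

/-- One step of the recursive count of the members of `𝒦` that contain `Z`. -/
theorem ncard_supers_le_of_step {𝒦 : Set (Submodule F X)} {d : ℕ}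
    (h𝒦 : ∀ K ∈ 𝒦, finrank F K = d) (hd : 1 ≤ d) {Z : Submodule F X} {bad : Set X}
    (hbad : bad.ncard ≤ Nat.card F ^ (d - 1)) {W : X → Submodule F X}
    (hW : ∀ K ∈ 𝒦, Z ≤ K → ∀ k ∈ K, W k ≤ K) {e : ℕ}
    (hB : ∀ k ∉ bad, {K | K ∈ 𝒦 ∧ W k ≤ K}.ncard ≤
      Nat.card F ^ ((finrank F X - d + 1) * e)) :
    {K | K ∈ 𝒦 ∧ Z ≤ K}.ncard ≤ Nat.card F ^ ((finrank F X - d + 1) * (e + 1)) := by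
  have h := ncard_supers_mul_le h𝒦 hd hbad hW hB
  by_cases hdX : d ≤ finrank F X
  · have hq : 0 < Nat.card F := Nat.card_pos
    refine Nat.le_of_mul_le_mul_right (h.trans (le_of_eq ?_)) (pow_pos hq (d - 1))
    rw [← pow_add, ← pow_add]
    congr 1
    rw [mul_add, mul_one]
    omega
  · have : {K | K ∈ 𝒦 ∧ Z ≤ K} = ∅ := by
      rw [Set.eq_empty_iff_forall_notMem]
      rintro K ⟨hK, -⟩
      exact hdX (h𝒦 K hK ▸ Submodule.finrank_le K)
    rw [this]; simp

/-- Each vector added to Z costs one factor q^(dim X - d + 1), and d - dim Z vectors complete Z to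
K. This is cruder than the Gaussian binomial but has the right leading exponent. -/
theorem ncard_finrank_eq_le (d : ℕ) (Z : Submodule F X) :
    {K : Submodule F X | finrank F K = d ∧ Z ≤ K}.ncard ≤
      Nat.card F ^ ((finrank F X - d + 1) * (d - finrank F Z)) := by
  induction hm : d - finrank F Z generalizing Z with
  | zero =>
    have : {K : Submodule F X | finrank F K = d ∧ Z ≤ K} ⊆ {Z} := by
      rintro K ⟨hK, hZ⟩
      exact (Submodule.eq_of_le_of_finrank_le hZ (by omega)).symm
    simpa using Set.ncard_le_ncard this
  | succ m ih =>
    refine ncard_supers_le_of_step (𝒦 := {K : Submodule F X | finrank F K = d})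
      (fun K hK => hK) (by omega) (bad := (Z : Set X)) ?_
      (W := fun k => Z ⊔ Submodule.span F {k}) ?_ ?_
    · rw [ncard_submodule]
      exact Nat.pow_le_pow_right Nat.card_pos (by omega)
    · intro K _ hZ k hk
      exact sup_le hZ (by simpa using hk)
    · intro k hk
      refine ih _ ?_
      rw [Submodule.finrank_sup_span_singleton (by simpa using hk)]
      omega

theorem ncard_finrank_eq_le' (d : ℕ) :
    {K : Submodule F X | finrank F K = d}.ncard ≤ Nat.card F ^ ((finrank F X - d + 1) * d) := by
  simpa using ncard_finrank_eq_le (F := F) (X := X) d ⊥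

theorem succ_le_card_pow (F : Type*) [Field F] [Finite F] (m : ℕ) :
    m + 1 ≤ Nat.card F ^ m :=
  (Nat.lt_pow_self (two_le_card_field F) : m < _)

/-- A union bound over the possible dimensions. -/
theorem ncard_le_of_finrank {𝒦 : Set (Submodule F X)} {e : ℕ}
    (h : ∀ d ≤ finrank F X, {K | K ∈ 𝒦 ∧ finrank F K = d}.ncard ≤ Nat.card F ^ e) :
    𝒦.ncard ≤ Nat.card F ^ (finrank F X + e) := by
  have h1 : 𝒦 ⊆ ⋃ d ∈ Finset.range (finrank F X + 1), {K | K ∈ 𝒦 ∧ finrank F K = d} := by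
    intro K hK
    simp only [Finset.mem_range, Set.mem_iUnion, exists_prop]
    exact ⟨finrank F K, Nat.lt_succ_of_le (Submodule.finrank_le K), hK, rfl⟩
  calc 𝒦.ncard ≤ _ := Set.ncard_le_ncard h1
    _ ≤ ∑ d ∈ Finset.range (finrank F X + 1), {K | K ∈ 𝒦 ∧ finrank F K = d}.ncard :=
      Finset.set_ncard_biUnion_le _ _
    _ ≤ ∑ d ∈ Finset.range (finrank F X + 1), Nat.card F ^ e :=
      Finset.sum_le_sum fun d hd => h d (by simpa [Nat.lt_succ_iff] using hd)
    _ = (finrank F X + 1) * Nat.card F ^ e := by simp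
    _ ≤ Nat.card F ^ (finrank F X) * Nat.card F ^ e :=
      Nat.mul_le_mul_right _ (succ_le_card_pow F _)
    _ = _ := (pow_add _ _ _).symm

/-- An exponent bounding the number of subspaces of an `m`-dimensional space. -/
def subspaceExp (m : ℕ) : ℕ := (m * m + 6 * m + 1) / 4

theorem subspaceExp_mono {a b : ℕ} (h : a ≤ b) : subspaceExp a ≤ subspaceExp b := by
  unfold subspaceExp
  gcongr

/-- With m = b + d the exponent (b + 1)d is at most (m + 1)²/4, and a further m pays for the union
over all dimensions d; the sum is the quotient defining `subspaceExp`. -/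
theorem card_submodule_le :
    Nat.card (Submodule F X) ≤ Nat.card F ^ subspaceExp (finrank F X) := by
  rw [← Set.ncard_univ]
  set m := finrank F X with hm
  have : m ≤ subspaceExp m := by
    unfold subspaceExp
    rw [Nat.le_div_iff_mul_le (by norm_num)]
    nlinarith
  obtain ⟨e, he⟩ := Nat.exists_eq_add_of_le this
  rw [he]
  refine ncard_le_of_finrank fun d hd => ?_
  simp only [Set.mem_univ, true_and]
  refine (ncard_finrank_eq_le' d).trans (Nat.pow_le_pow_right Nat.card_pos ?_)
  rw [← hm] at hd ⊢
  obtain ⟨b, hb⟩ := Nat.exists_eq_add_of_le hd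
  have h1 : m + (m - d + 1) * d ≤ subspaceExp m := by
    unfold subspaceExp
    rw [Nat.le_div_iff_mul_le (by norm_num)]
    rw [hb, Nat.add_sub_cancel_left]
    zify
    nlinarith [sq_nonneg ((b : ℤ) + 1 - d)]
  omega

/-- The number of subspaces between two given ones. -/
theorem ncard_between_le (P Q : Submodule F X) {m : ℕ} (hm : finrank F Q ≤ finrank F P + m) :
    {K : Submodule F X | P ≤ K ∧ K ≤ Q}.ncard ≤ Nat.card F ^ subspaceExp m := by
  by_cases hPQ : P ≤ Q
  swap
  · have : {K : Submodule F X | P ≤ K ∧ K ≤ Q} = ∅ := by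
      rw [Set.eq_empty_iff_forall_notMem]
      rintro K ⟨h1, h2⟩
      exact hPQ (h1.trans h2)
    rw [this]; simp
  let P' : Submodule F Q := P.comap Q.subtype
  have hP' : finrank F P' = finrank F P := (Submodule.comapSubtypeEquivOfLe hPQ).finrank_eq
  have hfr : finrank F (Q ⧸ P') ≤ m := by
    have := Submodule.finrank_quotient_add_finrank P'
    omega
  have : Finite (Q ⧸ P') := Finite.of_surjective _ P'.mkQ_surjective
  have hinj : {K : Submodule F X | P ≤ K ∧ K ≤ Q}.ncard ≤ Nat.card (Submodule F (Q ⧸ P')) := by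
    rw [← Nat.card_coe_set_eq]
    refine Nat.card_le_card_of_injective
      (fun K => ((K.1.comap Q.subtype).map P'.mkQ : Submodule F (Q ⧸ P'))) ?_
    rintro ⟨K, hK1, hK2⟩ ⟨L, hL1, hL2⟩ h
    simp only at h
    have h' := congrArg (Submodule.comap P'.mkQ) h
    have aux : ∀ {N : Submodule F X}, P ≤ N →
        ((N.comap Q.subtype).map P'.mkQ).comap P'.mkQ = N.comap Q.subtype := by
      intro N hN
      rw [Submodule.comap_map_mkQ]
      exact sup_eq_right.mpr (Submodule.comap_mono hN)
    rw [aux hK1, aux hL1] at h'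
    have h'' := congrArg (Submodule.map Q.subtype) h'
    rw [Submodule.map_comap_subtype, Submodule.map_comap_subtype, inf_eq_right.mpr hK2,
      inf_eq_right.mpr hL2] at h''
    exact Subtype.ext h''
  exact hinj.trans (card_submodule_le.trans
    (Nat.pow_le_pow_right Nat.card_pos (subspaceExp_mono hfr)))

/-- A subspace invariant under `N` lies between `N K` and `N⁻¹ N K`. -/
theorem ncard_invariant_le (N : X →ₗ[F] X) :
    {K : Submodule F X | K ≤ K.comap N}.ncard ≤
      Nat.card F ^ (subspaceExp (finrank F (LinearMap.range N)) +
        subspaceExp (finrank F (LinearMap.ker N))) := by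
  have := Fintype.ofFinite (Submodule F (LinearMap.range N))
  have h1 : {K : Submodule F X | K ≤ K.comap N} ⊆
      ⋃ C ∈ (Finset.univ : Finset (Submodule F (LinearMap.range N))),
        {K : Submodule F X | C.map (LinearMap.range N).subtype ≤ K ∧
          K ≤ (C.map (LinearMap.range N).subtype).comap N} := by
    intro K hK
    simp only [Finset.mem_univ, Set.mem_iUnion, exists_prop, true_and]
    have hC : ((K.map N).comap (LinearMap.range N).subtype).map (LinearMap.range N).subtype =
        K.map N := by
      rw [Submodule.map_comap_subtype, inf_eq_right]
      exact LinearMap.map_le_range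
    refine ⟨(K.map N).comap (LinearMap.range N).subtype, ?_⟩
    rw [Set.mem_ofPred_eq, hC]
    exact ⟨Submodule.map_le_iff_le_comap.mpr hK, Submodule.le_comap_map N K⟩
  calc _ ≤ _ := Set.ncard_le_ncard h1
    _ ≤ _ := Finset.set_ncard_biUnion_le _ _
    _ ≤ ∑ C ∈ (Finset.univ : Finset (Submodule F (LinearMap.range N))),
        Nat.card F ^ subspaceExp (finrank F (LinearMap.ker N)) := by
      refine Finset.sum_le_sum fun C _ => ncard_between_le _ _ ?_
      exact finrank_comap_le _ _
    _ = Nat.card (Submodule F (LinearMap.range N)) *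
        Nat.card F ^ subspaceExp (finrank F (LinearMap.ker N)) := by
      simp [Nat.card_eq_fintype_card]
    _ ≤ _ := by
      rw [pow_add]
      exact Nat.mul_le_mul_right _ card_submodule_le

/-- The bad vectors k are those for which k and Tk fail to be independent modulo Z: either k ∈ Z, or
(T - r)k ∈ Z for some scalar r. -/
theorem ncard_bad_le (T : X →ₗ[F] X) {ν : ℕ}
    (hν : ∀ r : F, finrank F (LinearMap.ker (T - r • LinearMap.id)) ≤ ν) (Z : Submodule F X) :
    ((Z : Set X) ∪ ⋃ r : F, (Z.comap (T - r • LinearMap.id) : Set X)).ncard ≤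
      Nat.card F ^ (finrank F Z + ν + 2) := by
  have := Fintype.ofFinite F
  set i := finrank F Z
  have hq := two_le_card_field F
  have hcom : ∀ r : F, (Z.comap (T - r • LinearMap.id) : Set X).ncard ≤ Nat.card F ^ (i + ν) := by
    intro r
    rw [ncard_submodule]
    refine Nat.pow_le_pow_right Nat.card_pos ?_
    exact (finrank_comap_le _ _).trans (Nat.add_le_add_left (hν r) _)
  have h1 : (⋃ r : F, (Z.comap (T - r • LinearMap.id) : Set X)).ncard ≤
      Nat.card F * Nat.card F ^ (i + ν) := by
    have := Finset.set_ncard_biUnion_le (Finset.univ : Finset F)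
      (fun r => (Z.comap (T - r • LinearMap.id) : Set X))
    simp only [Finset.mem_univ, Set.iUnion_true] at this
    refine this.trans ((Finset.sum_le_sum fun r _ => hcom r).trans ?_)
    simp [Nat.card_eq_fintype_card]
  refine (Set.ncard_union_le _ _).trans ((Nat.add_le_add (le_of_eq (ncard_submodule Z)) h1).trans ?_)
  have h2 : Nat.card F ^ i ≤ Nat.card F ^ (i + ν) := Nat.pow_le_pow_right Nat.card_pos (by omega)
  have h3 : Nat.card F ^ (i + ν) ≤ Nat.card F * Nat.card F ^ (i + ν) :=
    Nat.le_mul_of_pos_left _ Nat.card_pos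
  calc _ ≤ 2 * (Nat.card F * Nat.card F ^ (i + ν)) := by change Nat.card F ^ i + _ ≤ _; omega
    _ ≤ Nat.card F * (Nat.card F * Nat.card F ^ (i + ν)) := Nat.mul_le_mul_right _ hq
    _ = _ := by ring

/-- The invariant subspaces of an endomorphism without large eigenspaces are rare. -/
theorem ncard_invariant_finrank_eq_le (T : X →ₗ[F] X) {ν : ℕ}
    (hν : ∀ r : F, finrank F (LinearMap.ker (T - r • LinearMap.id)) ≤ ν) (d j : ℕ)
    (Z : Submodule F X) (hj : j = 0 ∨ finrank F Z + 2 * j + ν + 1 ≤ d) :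
    {K : Submodule F X | (finrank F K = d ∧ K ≤ K.comap T) ∧ Z ≤ K}.ncard ≤
      Nat.card F ^ ((finrank F X - d + 1) * (d - finrank F Z - j)) := by
  induction j generalizing Z with
  | zero =>
    refine le_trans (Set.ncard_le_ncard ?_) (ncard_finrank_eq_le d Z)
    rintro K ⟨⟨h1, -⟩, h2⟩
    exact ⟨h1, h2⟩
  | succ j ih =>
    have hj : finrank F Z + 2 * (j + 1) + ν + 1 ≤ d := hj.resolve_left (by omega)
    -- One good vector k raises dim Z by two, through k and Tk, at the price of a single factor; j
    -- counts these double steps.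
    have he : d - finrank F Z - (j + 1) = (d - (finrank F Z + 2) - j) + 1 := by omega
    rw [he]
    refine ncard_supers_le_of_step
      (𝒦 := {K : Submodule F X | finrank F K = d ∧ K ≤ K.comap T})
      (fun K hK => hK.1) (by omega)
      (bad := (Z : Set X) ∪ ⋃ r : F, (Z.comap (T - r • LinearMap.id) : Set X)) ?_
      (W := fun k => Z ⊔ Submodule.span F {k} ⊔ Submodule.span F {T k}) ?_ ?_
    · exact (ncard_bad_le T hν Z).trans (Nat.pow_le_pow_right Nat.card_pos (by omega))
    · intro K hK hZ k hk
      exact sup_le (sup_le hZ (by simpa using hk)) (by simpa using hK.2 hk)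
    · intro k hk
      simp only [Set.mem_union, SetLike.mem_coe, Set.mem_iUnion, Submodule.mem_comap,
        LinearMap.sub_apply, LinearMap.smul_apply, LinearMap.id_apply, not_or, not_exists] at hk
      have hTk : T k ∉ Z ⊔ Submodule.span F {k} := by
        intro hmem
        obtain ⟨z, hz, y, hy, hzy⟩ := Submodule.mem_sup.mp hmem
        obtain ⟨r, rfl⟩ := Submodule.mem_span_singleton.mp hy
        exact hk.2 r (by rw [← hzy]; simpa using hz)
      have hfr : finrank F ↥(Z ⊔ Submodule.span F {k} ⊔ Submodule.span F {T k}) =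
          finrank F Z + 2 := by
        rw [Submodule.finrank_sup_span_singleton hTk, Submodule.finrank_sup_span_singleton hk.1]
      have := ih (Z ⊔ Submodule.span F {k} ⊔ Submodule.span F {T k}) (by rw [hfr]; omega)
      rwa [hfr] at this

/-- The gain is the leading coefficient 25/128, strictly below the 1/4 of an unrestricted count of
subspaces. -/
theorem ncard_invariant_le_of_small_eigenspaces (T : X →ₗ[F] X)
    (hν : ∀ r : F, 4 * finrank F (LinearMap.ker (T - r • LinearMap.id)) ≤ finrank F X) :
    {K : Submodule F X | K ≤ K.comap T}.ncard ≤
      Nat.card F ^ (finrank F X + (5 * finrank F X + 16) ^ 2 / 128) := by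
  set D := finrank F X with hD
  refine ncard_le_of_finrank fun d hd => ?_
  rw [← hD] at hd
  -- As many double steps as the condition 2j + D/4 + 1 ≤ d allows; truncated subtraction gives j =
  -- 0 for small d.
  have h := ncard_invariant_finrank_eq_le T (ν := D / 4)
    (fun r => by have := hν r; omega) d ((d - D / 4 - 1) / 2) ⊥
    (by rw [finrank_bot]; omega)
  rw [finrank_bot] at h
  refine le_trans (Set.ncard_le_ncard ?_) (h.trans (Nat.pow_le_pow_right Nat.card_pos ?_))
  · rintro K ⟨h1, h2⟩
    exact ⟨⟨h2, h1⟩, bot_le⟩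
  · rw [← hD, Nat.le_div_iff_mul_le (by norm_num)]
    obtain ⟨b, hb⟩ := Nat.exists_eq_add_of_le hd
    have h8 : 8 * (d - 0 - (d - D / 4 - 1) / 2) ≤ 4 * d + D + 12 := by omega
    generalize d - 0 - (d - D / 4 - 1) / 2 = y at h8
    rw [hb, Nat.add_sub_cancel_left] at *
    have h9 : (b + 1) * (8 * y) ≤ (b + 1) * (4 * d + (d + b) + 12) := Nat.mul_le_mul_left _ h8
    zify at h9 ⊢
    -- With D = d + b, (5D + 16)² - (3b - 5d - 8)² = 16(b + 1)(5d + b + 12).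
    nlinarith [sq_nonneg (3 * (b : ℤ) - 5 * d - 8)]

end Counting

end NilpAlg
namespace NilpAlg

/-! ### Powers of an algebra and values of monomials -/

section Powers

variable {F : Type*} [Field F] {P : Type*} [NonUnitalNonAssocRing P] [Module F P]

theorem lift_id_map {α : Type*} (a : α → P) (m : FreeMagma α) :
    FreeMagma.lift id (FreeMagma.map a m) = FreeMagma.lift a m := by
  induction m with
  | ih1 x => rfl
  | ih2 x y hx hy => simp only [map_mul, hx, hy]

theorem lift_map {α β : Type*} (a : β → P) (ι : α → β) (m : FreeMagma α) :
    FreeMagma.lift a (FreeMagma.map ι m) = FreeMagma.lift (a ∘ ι) m := by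
  induction m with
  | ih1 x => rfl
  | ih2 x y hx hy => simp only [map_mul, hx, hy]

theorem length_map {α β : Type*} (ι : α → β) (m : FreeMagma α) :
    (FreeMagma.map ι m).length = m.length := by
  induction m with
  | ih1 x => rfl
  | ih2 x y hx hy =>
    rw [map_mul]
    exact congrArg₂ (· + ·) hx hy

theorem hom_lift {Q : Type*} [NonUnitalNonAssocRing Q] [Module F Q] {α : Type*}
    (φ : P →ₙₐ[F] Q) (a : α → P) (m : FreeMagma α) :
    φ (FreeMagma.lift a m) = FreeMagma.lift (fun i => φ (a i)) m := by
  induction m with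
  | ih1 x => rfl
  | ih2 x y hx hy => simp only [map_mul, hx, hy]

theorem lift_mem_power_length {α : Type*} (a : α → P) (m : FreeMagma α) :
    FreeMagma.lift a m ∈ power F P m.length :=
  Submodule.subset_span ⟨FreeMagma.map a m, length_map a m, lift_id_map a m⟩

theorem power_le {i : ℕ} {S : Submodule F P}
    (h : ∀ m : FreeMagma P, m.length = i → FreeMagma.lift id m ∈ S) : power F P i ≤ S := by
  refine Submodule.span_le.mpr ?_
  rintro _ ⟨m, hm, rfl⟩
  exact h m hm

theorem mem_power_one (x : P) : x ∈ power F P 1 :=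
  Submodule.subset_span ⟨FreeMagma.of x, rfl, rfl⟩

theorem hom_mem_power {Q : Type*} [NonUnitalNonAssocRing Q] [Module F Q] (φ : P →ₙₐ[F] Q)
    {i : ℕ} {x : P} (hx : x ∈ power F P i) : φ x ∈ power F Q i := by
  refine Submodule.span_induction ?_ ?_ ?_ ?_ hx
  · rintro _ ⟨m, rfl, rfl⟩
    rw [hom_lift]
    exact lift_mem_power_length _ m
  · rw [map_zero]; exact zero_mem _
  · intro x y _ _ hx hy
    rw [map_add]; exact add_mem hx hy
  · intro r x _ hx
    rw [map_smul]; exact Submodule.smul_mem _ _ hx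

variable [IsScalarTower F P P] [SMulCommClass F P P]

theorem mul_mem_power {i j : ℕ} {x y : P} (hx : x ∈ power F P i) (hy : y ∈ power F P j) :
    x * y ∈ power F P (i + j) := by
  refine Submodule.span_induction₂ (p := fun x y _ _ => x * y ∈ power F P (i + j))
    ?_ ?_ ?_ ?_ ?_ ?_ ?_ hx hy
  · rintro _ _ ⟨m, rfl, rfl⟩ ⟨m', rfl, rfl⟩
    rw [← map_mul]
    exact lift_mem_power_length id (m * m')
  · intro y _; rw [zero_mul]; exact zero_mem _
  · intro y _; rw [mul_zero]; exact zero_mem _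
  · intro x y z _ _ _ h1 h2; rw [add_mul]; exact add_mem h1 h2
  · intro x y z _ _ _ h1 h2; rw [mul_add]; exact add_mem h1 h2
  · intro r x y _ _ h; rw [smul_mul_assoc]; exact Submodule.smul_mem _ _ h
  · intro r x y _ _ h; rw [mul_smul_comm]; exact Submodule.smul_mem _ _ h

theorem lift_mem_power {α : Type*} (a : α → P) (m : FreeMagma α) {i : ℕ} (hi : 1 ≤ i)
    (him : i ≤ m.length) : FreeMagma.lift a m ∈ power F P i := by
  induction m generalizing i with
  | ih1 x =>
    have : i = 1 := le_antisymm him hi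
    subst this
    exact mem_power_one _
  | ih2 x y hx hy =>
    obtain rfl | hi' := hi.eq_or_lt
    · exact mem_power_one _
    have h1 := x.length_pos
    have h2 := y.length_pos
    have h3 : i ≤ x.length + y.length := him
    have : i = min x.length (i - 1) + (i - min x.length (i - 1)) := by omega
    rw [map_mul, this]
    exact mul_mem_power (hx (by omega) (by omega)) (hy (by omega) (by omega))

theorem power_antitone {i j : ℕ} (hi : 1 ≤ i) (hij : i ≤ j) : power F P j ≤ power F P i :=
  power_le fun m hm => lift_mem_power id m hi (by omega)

theorem mul_mem_power_two (x y : P) : x * y ∈ power F P 2 := by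
  have h := mul_mem_power (mem_power_one (F := F) x) (mem_power_one y)
  rwa [one_add_one_eq_two] at h

theorem mul_eq_zero_of_mem_power {c : ℕ} (h : power F P (c + 1) = ⊥) {x : P}
    (hx : x ∈ power F P c) (a : P) : x * a = 0 ∧ a * x = 0 := by
  constructor
  · have := mul_mem_power hx (mem_power_one (F := F) a)
    rwa [h] at this
  · have := mul_mem_power (mem_power_one (F := F) a) hx
    rwa [add_comm, h] at this

end Powers

/-! ### Variables occurring in a monomial -/

section Labels

variable {α : Type*} [DecidableEq α]

/-- The set of variables occurring in a nonassociative monomial. -/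
def labels : FreeMagma α → Finset α
  | .of a => {a}
  | .mul x y => labels x ∪ labels y

theorem labels_of (a : α) : labels (FreeMagma.of a) = {a} := rfl

theorem labels_mul (x y : FreeMagma α) : labels (x * y) = labels x ∪ labels y := rfl

theorem card_labels_le (m : FreeMagma α) : (labels m).card ≤ m.length := by
  induction m with
  | ih1 x => exact le_rfl
  | ih2 x y hx hy =>
    rw [labels_mul]
    exact (Finset.card_union_le _ _).trans (Nat.add_le_add hx hy)

theorem labels_map {β : Type*} [DecidableEq β] (ι : α → β) (m : FreeMagma α) :
    labels (FreeMagma.map ι m) = (labels m).image ι := by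
  induction m with
  | ih1 x => rfl
  | ih2 x y hx hy =>
    rw [map_mul, labels_mul, labels_mul, Finset.image_union, hx, hy]

variable {P : Type*} [NonUnitalNonAssocRing P]

theorem lift_congr {a b : α → P} {m : FreeMagma α} (h : ∀ i ∈ labels m, a i = b i) :
    FreeMagma.lift a m = FreeMagma.lift b m := by
  induction m with
  | ih1 x => exact h x (by simp [labels_of])
  | ih2 x y hx hy =>
    rw [labels_mul] at h
    rw [map_mul, map_mul,
      hx fun i hi => h i (Finset.mem_union_left _ hi),
      hy fun i hi => h i (Finset.mem_union_right _ hi)]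

theorem lift_eq_zero {a : α → P} {m : FreeMagma α} {i : α} (hi : i ∈ labels m) (h : a i = 0) :
    FreeMagma.lift a m = 0 := by
  induction m with
  | ih1 x =>
    rw [labels_of, Finset.mem_singleton] at hi
    subst hi
    exact h
  | ih2 x y hx hy =>
    rw [labels_mul, Finset.mem_union] at hi
    rw [map_mul]
    rcases hi with hi | hi
    · rw [hx hi, zero_mul]
    · rw [hy hi, mul_zero]

end Labels

/-! ### Leading components with respect to a weight -/

section Leading

open Module

variable {F X Y ι : Type*} [Field F] [AddCommGroup X] [Module F X]
  [AddCommGroup Y] [Module F Y]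

/-- The elements of `K` that are killed by all `q i'` with `i'` of smaller weight than `i`. -/
def leadSub (q : ι → X →ₗ[F] Y) (ρ : ι → ℕ) (K : Submodule F X) (i : ι) : Submodule F X :=
  K ⊓ ⨅ i', ⨅ (_ : ρ i' < ρ i), LinearMap.ker (q i')

theorem mem_leadSub {q : ι → X →ₗ[F] Y} {ρ : ι → ℕ} {K : Submodule F X} {i : ι} {k : X} :
    k ∈ leadSub q ρ K i ↔ k ∈ K ∧ ∀ i', ρ i' < ρ i → q i' k = 0 := by
  simp [leadSub]

variable [FiniteDimensional F X]

theorem finrank_inf_ker_add_finrank_map (A : Submodule F X) (f : X →ₗ[F] Y) :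
    finrank F ↥(A ⊓ LinearMap.ker f) + finrank F (A.map f) = finrank F A := by
  have h := LinearMap.finrank_range_add_finrank_ker (f.domRestrict A)
  rw [LinearMap.range_domRestrict, LinearMap.ker_domRestrict] at h
  have h2 : finrank F ↥((LinearMap.ker f).comap A.subtype) =
      finrank F ↥(A ⊓ LinearMap.ker f) := by
    rw [← Submodule.map_comap_subtype]
    exact (Submodule.finrank_map_subtype_eq _ _).symm
  rw [← h, ← h2, add_comm]

/-- Filter K by the successive vanishing of the `q i` in order of weight: the graded pieces are the
spaces of leading components, and what remains is the common kernel. Injectivity of the weight makes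
the order total. -/
theorem finrank_eq_sum_leadSub [Fintype ι] {q : ι → X →ₗ[F] Y} {ρ : ι → ℕ}
    (hρ : Function.Injective ρ) (K : Submodule F X) :
    finrank F ↥(K ⊓ ⨅ i, LinearMap.ker (q i)) +
      ∑ i, finrank F ((leadSub q ρ K i).map (q i)) = finrank F K := by
  classical
  have key : ∀ s : Finset ι, finrank F ↥(K ⊓ ⨅ i ∈ s, LinearMap.ker (q i)) +
      ∑ i ∈ s, finrank F ((K ⊓ ⨅ i' ∈ s, ⨅ (_ : ρ i' < ρ i), LinearMap.ker (q i')).map (q i)) =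
        finrank F K := by
    intro s
    -- The new index is the heaviest, so its lead space is everything killed by the earlier maps,
    -- while the lead spaces of the earlier indices do not change.
    induction s using Finset.induction_on_max_value ρ with
    | empty =>
      have h0 : (⨅ i ∈ (∅ : Finset ι), LinearMap.ker (q i)) = ⊤ := by simp
      rw [Finset.sum_empty, h0, inf_top_eq, add_zero]
    | insert a s ha hmax ih =>
      rw [Finset.sum_insert ha]
      have h1 : (K ⊓ ⨅ i' ∈ insert a s, ⨅ (_ : ρ i' < ρ a), LinearMap.ker (q i')) =
          K ⊓ ⨅ i ∈ s, LinearMap.ker (q i) := by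
        ext k
        simp only [Submodule.mem_inf, Submodule.mem_iInf, LinearMap.mem_ker, Finset.mem_insert]
        refine and_congr_right fun _ => ⟨fun h i hi => h i (Or.inr hi) ?_, fun h i hi hlt => ?_⟩
        · exact lt_of_le_of_ne (hmax i hi) (fun e => ha (hρ e ▸ hi))
        · rcases hi with rfl | hi
          · exact absurd hlt (lt_irrefl _)
          · exact h i hi
      have h2 : ∀ i ∈ s, (K ⊓ ⨅ i' ∈ insert a s, ⨅ (_ : ρ i' < ρ i), LinearMap.ker (q i')) =
          K ⊓ ⨅ i' ∈ s, ⨅ (_ : ρ i' < ρ i), LinearMap.ker (q i') := by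
        intro i hi
        ext k
        simp only [Submodule.mem_inf, Submodule.mem_iInf, LinearMap.mem_ker, Finset.mem_insert]
        refine and_congr_right fun _ => ⟨fun h i' hi' => h i' (Or.inr hi'), fun h i' hi' hlt => ?_⟩
        rcases hi' with rfl | hi'
        · exact absurd hlt (not_lt.mpr (hmax i hi))
        · exact h i' hi' hlt
      rw [h1, Finset.sum_congr rfl fun i hi => by rw [h2 i hi]]
      have h3 : (K ⊓ ⨅ i ∈ insert a s, LinearMap.ker (q i)) =
          (K ⊓ ⨅ i ∈ s, LinearMap.ker (q i)) ⊓ LinearMap.ker (q a) := by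
        rw [Finset.iInf_insert, inf_comm (LinearMap.ker (q a)), inf_assoc]
      rw [h3, ← add_assoc, finrank_inf_ker_add_finrank_map, ih]
  have h := key Finset.univ
  have h1 : (⨅ i ∈ (Finset.univ : Finset ι), LinearMap.ker (q i)) = ⨅ i, LinearMap.ker (q i) := by
    simp
  have h2 : ∀ i, (K ⊓ ⨅ i' ∈ (Finset.univ : Finset ι), ⨅ (_ : ρ i' < ρ i), LinearMap.ker (q i')) =
      leadSub q ρ K i := by
    intro i; simp [leadSub]
  rwa [h1, Finset.sum_congr rfl fun i _ => by rw [h2 i]] at h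

end Leading

end NilpAlg
namespace NilpAlg

/-! ### Decomposition by sets of variables, and expansion of multiplication -/

section Expansion

open Module

variable {F : Type*} [Field F] {R : Type*} [NonUnitalNonAssocRing R] [Module F R]
  [IsScalarTower F R R] [SMulCommClass F R R]

/-- The properties of the free generators `x` of the relatively free algebra of rank `n` of a
central `c`-step nilpotent class that the dimension estimates use. -/
structure IsFreeCentral (F : Type*) [Field F] {R : Type*} [NonUnitalNonAssocRing R] [Module F R]
    [IsScalarTower F R R] [SMulCommClass F R R] (c : ℕ) {n : ℕ} (x : Fin n → R) : Prop where
  span_eq_top : Submodule.span F (Set.range (FreeMagma.lift x)) = ⊤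
  exists_hom : ∀ a : Fin n → R, ∃ φ : R →ₙₐ[F] R, ∀ i, φ (x i) = a i
  power_succ_eq_bot : power F R (c + 1) = ⊥
  annihilator_eq : annihilator F R = power F R c

namespace IsFreeCentral

variable {c n : ℕ} {x : Fin n → R} (hx : IsFreeCentral F c x)

include hx

theorem linearMap_ext {Y : Type*} [AddCommGroup Y] [Module F Y] {f g : R →ₗ[F] Y}
    (h : ∀ m, f (FreeMagma.lift x m) = g (FreeMagma.lift x m)) : f = g :=
  LinearMap.ext_on_range hx.span_eq_top h

/-- Inclusion-exclusion: substituting 0 for the variables outside T keeps the monomials supported in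
T, and the projections to proper subsets are subtracted. Only zero substitutions are used, so a
small field does no harm. -/
theorem exists_suppProj (T : Finset (Fin n)) : ∃ p : R →ₗ[F] R, ∀ m : FreeMagma (Fin n),
    p (FreeMagma.lift x m) = if labels m = T then FreeMagma.lift x m else 0 := by
  induction T using Finset.strongInduction with
  | H T ih =>
    choose! p hp using ih
    obtain ⟨e, he⟩ := hx.exists_hom fun i => if i ∈ T then x i else 0
    refine ⟨(e : R →ₗ[F] R) - ∑ S ∈ T.ssubsets, p S, fun m => ?_⟩
    have he' : e (FreeMagma.lift x m) = if labels m ⊆ T then FreeMagma.lift x m else 0 := by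
      rw [hom_lift]
      split_ifs with h
      · exact lift_congr fun i hi => by rw [he, if_pos (h hi)]
      · obtain ⟨i, hi, hiT⟩ := Finset.not_subset.mp h
        exact lift_eq_zero hi (by rw [he, if_neg hiT])
    have hsum : (∑ S ∈ T.ssubsets, p S) (FreeMagma.lift x m) =
        if labels m ∈ T.ssubsets then FreeMagma.lift x m else 0 := by
      rw [LinearMap.sum_apply, Finset.sum_congr rfl fun S hS =>
        hp S (Finset.mem_ssubsets.mp hS) m, Finset.sum_ite_eq]
    rw [LinearMap.sub_apply, hsum]
    change e _ - _ = _
    rw [he']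
    simp only [Finset.mem_ssubsets]
    by_cases h1 : labels m = T
    · simp [h1]
    · by_cases h2 : labels m ⊆ T
      · simp [h1, h2, Finset.ssubset_iff_subset_ne]
      · have : ¬ labels m ⊂ T := fun h => h2 h.subset
        simp [h1, h2, this]

/-- The projection to the part of `R` spanned by the monomials with set of variables `T`. -/
noncomputable def suppProj (T : Finset (Fin n)) : R →ₗ[F] R := (hx.exists_suppProj T).choose

theorem suppProj_lift (T : Finset (Fin n)) (m : FreeMagma (Fin n)) :
    hx.suppProj T (FreeMagma.lift x m) = if labels m = T then FreeMagma.lift x m else 0 :=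
  (hx.exists_suppProj T).choose_spec m

theorem sum_suppProj (k : R) : ∑ T, hx.suppProj T k = k := by
  have : ∑ T, hx.suppProj T = LinearMap.id := by
    refine hx.linearMap_ext fun m => ?_
    rw [LinearMap.sum_apply]
    simp only [suppProj_lift]
    simp
  rw [← LinearMap.sum_apply, this, LinearMap.id_apply]

theorem suppProj_mem_power {T : Finset (Fin n)} (hc : 1 ≤ c) (hT : c ≤ T.card) (k : R) :
    hx.suppProj T k ∈ power F R c := by
  have hk : k ∈ Submodule.span F (Set.range (FreeMagma.lift x)) := by
    rw [hx.span_eq_top]; trivial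
  refine Submodule.span_induction (p := fun k _ => hx.suppProj T k ∈ power F R c)
    ?_ ?_ ?_ ?_ hk
  · rintro _ ⟨m, rfl⟩
    rw [suppProj_lift]
    split_ifs with h
    · exact lift_mem_power x m hc (hT.trans (h ▸ card_labels_le m))
    · exact zero_mem _
  · rw [map_zero]; exact zero_mem _
  · intro a b _ _ h1 h2; rw [map_add]; exact add_mem h1 h2
  · intro r a _ h; rw [map_smul]; exact Submodule.smul_mem _ _ h

/-- A monomial of k yields support S after multiplication by `x j` exactly when its support is S or
S without j, with j ∈ S. -/
theorem suppProj_mul_gen (S : Finset (Fin n)) (j : Fin n) (k : R) :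
    hx.suppProj S (k * x j) =
      if j ∈ S then (hx.suppProj S k + hx.suppProj (S.erase j) k) * x j else 0 := by
  split_ifs with hj
  · have : hx.suppProj S ∘ₗ LinearMap.mulRight F (x j) = LinearMap.mulRight F (x j) ∘ₗ
        (hx.suppProj S + hx.suppProj (S.erase j)) := by
      refine hx.linearMap_ext fun m => ?_
      have h := hx.suppProj_lift S (m * FreeMagma.of j)
      rw [map_mul, FreeMagma.lift_of, labels_mul, labels_of] at h
      simp only [LinearMap.comp_apply, LinearMap.mulRight_apply, LinearMap.add_apply, h,
        suppProj_lift]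
      by_cases hjm : j ∈ labels m
      · have h1 : labels m ∪ {j} = labels m := by simpa using hjm
        have h2 : labels m ≠ S.erase j := fun h => by simp [h] at hjm
        rw [h1, if_neg h2, add_zero]
        split_ifs <;> simp
      · have h1 : labels m ≠ S := fun h => hjm (h ▸ hj)
        have h2 : labels m ∪ {j} = S ↔ labels m = S.erase j := by
          rw [Finset.union_comm, ← Finset.insert_eq]
          constructor
          · rintro rfl; simp [hjm]
          · intro h; rw [h, Finset.insert_erase hj]
        simp only [h1, h2, if_false, zero_add]
        split_ifs <;> simp
    exact LinearMap.congr_fun this k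
  · have : hx.suppProj S ∘ₗ LinearMap.mulRight F (x j) = 0 := by
      refine hx.linearMap_ext fun m => ?_
      have h := hx.suppProj_lift S (m * FreeMagma.of j)
      rw [map_mul, FreeMagma.lift_of, labels_mul, labels_of, if_neg] at h
      · simpa using h
      · rintro rfl; simp at hj
    exact LinearMap.congr_fun this k

theorem suppProj_gen_mul (S : Finset (Fin n)) (j : Fin n) (k : R) :
    hx.suppProj S (x j * k) =
      if j ∈ S then x j * (hx.suppProj S k + hx.suppProj (S.erase j) k) else 0 := by
  split_ifs with hj
  · have : hx.suppProj S ∘ₗ LinearMap.mulLeft F (x j) = LinearMap.mulLeft F (x j) ∘ₗ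
        (hx.suppProj S + hx.suppProj (S.erase j)) := by
      refine hx.linearMap_ext fun m => ?_
      have h := hx.suppProj_lift S (FreeMagma.of j * m)
      rw [map_mul, FreeMagma.lift_of, labels_mul, labels_of] at h
      simp only [LinearMap.comp_apply, LinearMap.mulLeft_apply, LinearMap.add_apply, h,
        suppProj_lift]
      by_cases hjm : j ∈ labels m
      · have h1 : {j} ∪ labels m = labels m := by simpa using hjm
        have h2 : labels m ≠ S.erase j := fun h => by simp [h] at hjm
        rw [h1, if_neg h2, add_zero]
        split_ifs <;> simp
      · have h1 : labels m ≠ S := fun h => hjm (h ▸ hj)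
        have h2 : {j} ∪ labels m = S ↔ labels m = S.erase j := by
          rw [← Finset.insert_eq]
          constructor
          · rintro rfl; simp [hjm]
          · intro h; rw [h, Finset.insert_erase hj]
        simp only [h1, h2, if_false, zero_add]
        split_ifs <;> simp
    exact LinearMap.congr_fun this k
  · have : hx.suppProj S ∘ₗ LinearMap.mulLeft F (x j) = 0 := by
      refine hx.linearMap_ext fun m => ?_
      have h := hx.suppProj_lift S (FreeMagma.of j * m)
      rw [map_mul, FreeMagma.lift_of, labels_mul, labels_of, if_neg] at h
      · simpa using h
      · rintro rfl; simp at hj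
    exact LinearMap.congr_fun this k

/-- An element not involving `x j` that is annihilated by `x j` lies in the annihilator. -/
theorem suppProj_mem_power_of_mul_eq_zero {T : Finset (Fin n)} {j : Fin n} (hj : j ∉ T) {k : R}
    (h1 : hx.suppProj T k * x j = 0) (h2 : x j * hx.suppProj T k = 0) :
    hx.suppProj T k ∈ power F R c := by
  rw [← hx.annihilator_eq]
  intro a
  -- Replacing `x j` by an arbitrary a fixes the component, in which `x j` does not occur, and turns
  -- annihilation by `x j` into annihilation by a.
  obtain ⟨e, he⟩ := hx.exists_hom (Function.update x j a)
  have hfix : e (hx.suppProj T k) = hx.suppProj T k := by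
    have : (e : R →ₗ[F] R) ∘ₗ hx.suppProj T = hx.suppProj T := by
      refine hx.linearMap_ext fun m => ?_
      rw [LinearMap.comp_apply, suppProj_lift]
      split_ifs with h
      · change e _ = _
        rw [hom_lift]
        refine lift_congr fun i hi => ?_
        rw [he, Function.update_of_ne]
        rintro rfl
        exact hj (h ▸ hi)
      · simp
    exact LinearMap.congr_fun this k
  have hej : e (x j) = a := by rw [he, Function.update_self]
  constructor
  · have := congrArg e h2
    rwa [map_mul, map_zero, hfix, hej] at this
  · have := congrArg e h1
    rwa [map_mul, map_zero, hfix, hej] at this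

/-- If k leads at T modulo R^c, its products with `x j` can have no component before `insert j T`,
and there they show only the leading component of k times `x j`: all earlier components lie in R^c
and are killed by multiplication. -/
theorem suppProj_mul_gen_eq_zero {U : Submodule F R} {ρ : Finset (Fin n) → ℕ} {T : Finset (Fin n)}
    {j : Fin n} (hj : j ∉ T)
    (hρ : ∀ S : Finset (Fin n), j ∈ S → ρ S < ρ (insert j T) → ρ (S.erase j) < ρ T)
    (hρ' : ρ (insert j T) < ρ T) {k : R}
    (hk : k ∈ leadSub (fun T => (power F R c).mkQ ∘ₗ hx.suppProj T) ρ U T) :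
    (∀ S, ρ S < ρ (insert j T) → hx.suppProj S (k * x j) = 0 ∧ hx.suppProj S (x j * k) = 0) ∧
      hx.suppProj (insert j T) (k * x j) = hx.suppProj T k * x j ∧
      hx.suppProj (insert j T) (x j * k) = x j * hx.suppProj T k := by
  have hk' : ∀ S, ρ S < ρ T → ∀ a, hx.suppProj S k * a = 0 ∧ a * hx.suppProj S k = 0 := by
    intro S hS
    have := (mem_leadSub.mp hk).2 S hS
    rw [LinearMap.comp_apply, Submodule.mkQ_apply, Submodule.Quotient.mk_eq_zero] at this
    exact mul_eq_zero_of_mem_power hx.power_succ_eq_bot this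
  refine ⟨fun S hS => ?_, ?_, ?_⟩
  · rw [suppProj_mul_gen, suppProj_gen_mul]
    split_ifs with hjS
    · have h1 := hk' S (hS.trans hρ') (x j)
      have h2 := hk' _ (hρ S hjS hS) (x j)
      rw [add_mul, mul_add, h1.1, h1.2, h2.1, h2.2, add_zero]
      exact ⟨rfl, rfl⟩
    · exact ⟨rfl, rfl⟩
  · rw [suppProj_mul_gen, if_pos (Finset.mem_insert_self _ _), Finset.erase_insert hj, add_mul,
      (hk' _ hρ' (x j)).1, zero_add]
  · rw [suppProj_gen_mul, if_pos (Finset.mem_insert_self _ _), Finset.erase_insert hj, mul_add,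
      (hk' _ hρ' (x j)).2, zero_add]

variable [FiniteDimensional F R]

/-- The right and left products with `x j` together determine a leading component at T modulo R^c,
and both are leading components of M at `insert j T`; the two sides account for the factor 2. -/
theorem finrank_map_lead_le {U M : Submodule F R} (hM : ∀ u ∈ U, ∀ a, u * a ∈ M ∧ a * u ∈ M)
    {ρ : Finset (Fin n) → ℕ} {T : Finset (Fin n)} {j : Fin n} (hj : j ∉ T)
    (hρ : ∀ S : Finset (Fin n), j ∈ S → ρ S < ρ (insert j T) → ρ (S.erase j) < ρ T)
    (hρ' : ρ (insert j T) < ρ T) :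
    finrank F ((leadSub (fun T => (power F R c).mkQ ∘ₗ hx.suppProj T) ρ U T).map
      ((power F R c).mkQ ∘ₗ hx.suppProj T)) ≤
      2 * finrank F ((leadSub hx.suppProj ρ M (insert j T)).map (hx.suppProj (insert j T))) := by
  set A := (leadSub (fun T => (power F R c).mkQ ∘ₗ hx.suppProj T) ρ U T).map (hx.suppProj T)
    with hA
  set B := (leadSub hx.suppProj ρ M (insert j T)).map (hx.suppProj (insert j T)) with hB
  rw [Submodule.map_comp, ← hA]
  let Φ : R →ₗ[F] R × R := (LinearMap.mulRight F (x j)).prod (LinearMap.mulLeft F (x j))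
  have h1 := finrank_inf_ker_add_finrank_map A (power F R c).mkQ
  have h2 := finrank_inf_ker_add_finrank_map A Φ
  rw [Submodule.ker_mkQ] at h1
  have h3 : finrank F ↥(A ⊓ LinearMap.ker Φ) ≤ finrank F ↥(A ⊓ power F R c) := by
    refine Submodule.finrank_mono ?_
    rintro _ ⟨⟨k, hk, rfl⟩, hΦ⟩
    have hΦ' : hx.suppProj T k * x j = 0 ∧ x j * hx.suppProj T k = 0 := by
      simpa [Φ] using hΦ
    exact ⟨⟨k, hk, rfl⟩, hx.suppProj_mem_power_of_mul_eq_zero hj hΦ'.1 hΦ'.2⟩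
  have h4 : finrank F (A.map Φ) ≤ finrank F (B.prod B) := by
    refine Submodule.finrank_mono ?_
    rintro _ ⟨_, ⟨k, hk, rfl⟩, rfl⟩
    obtain ⟨e1, e2, e3⟩ := hx.suppProj_mul_gen_eq_zero hj hρ hρ' hk
    have hkM := hM k (mem_leadSub.mp hk).1 (x j)
    exact ⟨⟨k * x j, mem_leadSub.mpr ⟨hkM.1, fun S hS => (e1 S hS).1⟩, e2⟩,
      ⟨x j * k, mem_leadSub.mpr ⟨hkM.2, fun S hS => (e1 S hS).2⟩, e3⟩⟩
  have h5 : finrank F (B.prod B) ≤ finrank F (B × B) :=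
    LinearMap.finrank_le_finrank_of_injective
      (f := ((LinearMap.fst F R R ∘ₗ (B.prod B).subtype).codRestrict B fun b => b.2.1).prod
        ((LinearMap.snd F R R ∘ₗ (B.prod B).subtype).codRestrict B fun b => b.2.2)) (by
        intro a b e
        have e1 := congrArg (fun z : B × B => (z.1 : R)) e
        have e2 := congrArg (fun z : B × B => (z.2 : R)) e
        exact Subtype.ext (Prod.ext e1 e2))
  rw [finrank_prod] at h5
  omega

/-- Multiplication expands: the products of the elements of `U` with arbitrary elements span a
space much larger than `U` itself. -/
theorem expansion (hc : 1 ≤ c) {U M : Submodule F R}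
    (hM : ∀ u ∈ U, ∀ a, u * a ∈ M ∧ a * u ∈ M) :
    (n - c) * finrank F (U.map (power F R c).mkQ) ≤ 2 * c * finrank F M := by
  classical
  -- Binary code of the complement: a total order in which inserting j lowers the weight by exactly
  -- 2^j, so that it is compatible with multiplication by `x j`.
  let ρ : Finset (Fin n) → ℕ := fun T => ∑ i ∈ Tᶜ, 2 ^ (i : ℕ)
  have hρinj : Function.Injective ρ := by
    intro S T hST
    have : Function.Injective fun s : Finset ℕ => ∑ i ∈ s, 2 ^ i :=
      Finset.geomSum_injective le_rfl
    have h := @this (Sᶜ.map Fin.valEmbedding) (Tᶜ.map Fin.valEmbedding) (by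
      simpa [Finset.sum_map] using hST)
    exact compl_injective (Finset.map_injective _ h)
  have hins : ∀ (T : Finset (Fin n)) (j : Fin n), j ∉ T → ρ T = ρ (insert j T) + 2 ^ (j : ℕ) := by
    intro T j hj
    have : Tᶜ = insert j (insert j T)ᶜ := by
      ext i; by_cases h : i = j <;> simp [h, hj]
    simp only [ρ]
    rw [this, Finset.sum_insert (by simp)]
    simp [add_comm]
  let u : Finset (Fin n) → ℕ := fun T =>
    finrank F ((leadSub (fun T => (power F R c).mkQ ∘ₗ hx.suppProj T) ρ U T).map
      ((power F R c).mkQ ∘ₗ hx.suppProj T))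
  let w : Finset (Fin n) → ℕ := fun S =>
    finrank F ((leadSub hx.suppProj ρ M S).map (hx.suppProj S))
  have huw : ∀ T j, j ∉ T → u T ≤ 2 * w (insert j T) := by
    intro T j hj
    refine hx.finrank_map_lead_le hM hj (fun S hS h => ?_) (by rw [hins T j hj]; simp)
    have := hins (S.erase j) j (by simp)
    rw [Finset.insert_erase hS] at this
    rw [this, hins T j hj]
    omega
  have hu0 : ∀ T, c ≤ T.card → u T = 0 := by
    intro T hT
    have : ((power F R c).mkQ ∘ₗ hx.suppProj T) = 0 := by
      ext k
      rw [LinearMap.comp_apply, Submodule.mkQ_apply, LinearMap.zero_apply,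
        Submodule.Quotient.mk_eq_zero]
      exact hx.suppProj_mem_power hc hT k
    simp only [u]
    rw [this, Submodule.map_zero, finrank_bot]
  have hU : finrank F (U.map (power F R c).mkQ) ≤ ∑ T, u T := by
    have h1 := finrank_eq_sum_leadSub (q := fun T => (power F R c).mkQ ∘ₗ hx.suppProj T) hρinj U
    have h2 := finrank_inf_ker_add_finrank_map U (power F R c).mkQ
    have h3 : finrank F ↥(U ⊓ ⨅ T, LinearMap.ker ((power F R c).mkQ ∘ₗ hx.suppProj T)) ≤
        finrank F ↥(U ⊓ LinearMap.ker (power F R c).mkQ) := by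
      refine Submodule.finrank_mono (inf_le_inf_left _ ?_)
      intro k hk
      rw [Submodule.mem_iInf] at hk
      rw [LinearMap.mem_ker, ← hx.sum_suppProj k, map_sum]
      exact Finset.sum_eq_zero fun T _ => LinearMap.mem_ker.mp (hk T)
    change _ + ∑ T, u T = _ at h1
    omega
  have hW : ∑ S, w S ≤ finrank F M := by
    have h1 := finrank_eq_sum_leadSub (q := hx.suppProj) hρinj M
    change _ + ∑ S, w S = _ at h1
    omega
  have hpair : ∀ T, (n - c) * u T ≤ ∑ j ∈ Tᶜ, if T.card < c then 2 * w (insert j T) else 0 := by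
    intro T
    split_ifs with hT
    · refine le_trans ?_ (Finset.sum_le_sum fun j hj => huw T j (Finset.mem_compl.mp hj))
      rw [Finset.sum_const, smul_eq_mul, Finset.card_compl, Fintype.card_fin]
      exact Nat.mul_le_mul_right _ (by omega)
    · rw [hu0 T (not_lt.mp hT)]; simp
  -- Double counting: each T with fewer than c elements has at least n - c extensions, while each S
  -- with at most c elements arises from at most c sets T.
  have hswap : ∑ T : Finset (Fin n), ∑ j ∈ Tᶜ, (if T.card < c then 2 * w (insert j T) else 0) =
      ∑ S : Finset (Fin n), ∑ j ∈ S, if S.card ≤ c then 2 * w S else 0 := by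
    rw [Finset.sum_sigma', Finset.sum_sigma']
    refine Finset.sum_bij' (fun p _ => ⟨insert p.2 p.1, p.2⟩) (fun p _ => ⟨p.1.erase p.2, p.2⟩)
      ?_ ?_ ?_ ?_ ?_
    · rintro ⟨T, j⟩ h; simp
    · rintro ⟨T, j⟩ h; simp
    · rintro ⟨T, j⟩ h
      have : j ∉ T := by simpa using h
      simp [this]
    · rintro ⟨T, j⟩ h
      have : j ∈ T := by simpa using h
      simp [this]
    · rintro ⟨T, j⟩ h
      have : j ∉ T := by simpa using h
      simp [Finset.card_insert_of_notMem this]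
  calc (n - c) * finrank F (U.map (power F R c).mkQ) ≤ (n - c) * ∑ T, u T :=
        Nat.mul_le_mul_left _ hU
    _ = ∑ T, (n - c) * u T := Finset.mul_sum _ _ _
    _ ≤ _ := Finset.sum_le_sum fun T _ => hpair T
    _ = _ := hswap
    _ ≤ ∑ S : Finset (Fin n), 2 * c * w S := by
      refine Finset.sum_le_sum fun S _ => ?_
      split_ifs with hS
      · rw [Finset.sum_const, smul_eq_mul]
        calc S.card * (2 * w S) ≤ c * (2 * w S) := Nat.mul_le_mul_right _ hS
          _ = _ := by ring
      · simp
    _ = 2 * c * ∑ S, w S := (Finset.mul_sum _ _ _).symm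
    _ ≤ _ := Nat.mul_le_mul_left _ hW

end IsFreeCentral

end Expansion

end NilpAlg
namespace NilpAlg

/-! ### Lower bounds for the dimension of R^c and for the rank of T - r -/

section Rank

open Module

theorem map_map_freeMagma {α β γ : Type*} (f : α → β) (g : β → γ) (m : FreeMagma α) :
    FreeMagma.map g (FreeMagma.map f m) = FreeMagma.map (g ∘ f) m := by
  induction m with
  | ih1 x => rfl
  | ih2 x y hx hy => rw [map_mul, map_mul, map_mul, hx, hy]

/-- Every nonassociative monomial of degree `c` is a value of one in which `c` distinct variables
occur. -/
theorem exists_shape {P : Type*} (m : FreeMagma P) {c : ℕ} (hc : m.length = c) :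
    ∃ (t : FreeMagma (Fin c)) (a : Fin c → P),
      FreeMagma.map a t = m ∧ labels t = Finset.univ := by
  induction m generalizing c with
  | ih1 p =>
    obtain rfl : 1 = c := hc
    exact ⟨FreeMagma.of 0, fun _ => p, rfl, by decide +revert⟩
  | ih2 m₁ m₂ h₁ h₂ =>
    obtain rfl : m₁.length + m₂.length = c := hc
    obtain ⟨t₁, a₁, e₁, l₁⟩ := h₁ rfl
    obtain ⟨t₂, a₂, e₂, l₂⟩ := h₂ rfl
    refine ⟨FreeMagma.map (Fin.castAdd m₂.length) t₁ * FreeMagma.map (Fin.natAdd m₁.length) t₂,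
      Fin.append a₁ a₂, ?_, ?_⟩
    · rw [map_mul, map_map_freeMagma, map_map_freeMagma]
      have h1 : Fin.append a₁ a₂ ∘ Fin.castAdd m₂.length = a₁ := by
        funext i; simp
      have h2 : Fin.append a₁ a₂ ∘ Fin.natAdd m₁.length = a₂ := by
        funext i; simp
      rw [h1, h2, e₁, e₂]
    · rw [labels_mul, labels_map, labels_map, l₁, l₂]
      ext i
      refine Fin.addCases (fun i => ?_) (fun i => ?_) i <;> simp

theorem linearIndependent_of_separating {F X Y J : Type*} [Field F] [AddCommGroup X] [Module F X]
    [AddCommGroup Y] [Module F Y] {y : J → X} (ψ : J → X →ₗ[F] Y)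
    (h0 : ∀ i j, i ≠ j → ψ i (y j) = 0) (h1 : ∀ j, ψ j (y j) ≠ 0) : LinearIndependent F y := by
  rw [linearIndependent_iff']
  intro s g hg i hi
  have h := congrArg (ψ i) hg
  rw [map_sum, map_zero, Finset.sum_eq_single i] at h
  · rw [map_smul] at h
    exact (smul_eq_zero.mp h).resolve_right (h1 i)
  · intro j _ hj
    rw [map_smul, h0 i j hj.symm, smul_zero]
  · intro hi'; exact absurd hi hi'

theorem exists_basis_extending_pair {F : Type*} [Field F] {n : ℕ} {u w : Fin n → F}
    (h : LinearIndependent F ![u, w]) : ∃ b : Basis (Fin n) F (Fin n → F),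
      ∀ i : Fin n, ((i : ℕ) = 0 → b i = u) ∧ ((i : ℕ) = 1 → b i = w) := by
  classical
  have hn : 2 ≤ n := by simpa using h.fintype_card_le_finrank
  have hsub := h.linearIndepOn_id.subset_extend (Set.subset_univ _)
  let b := Basis.extend h.linearIndepOn_id
  let iu : h.linearIndepOn_id.extend (Set.subset_univ _) := ⟨u, hsub ⟨0, rfl⟩⟩
  let iw : h.linearIndepOn_id.extend (Set.subset_univ _) := ⟨w, hsub ⟨1, rfl⟩⟩
  have hne : iu ≠ iw := fun e => by
    have h01 : (0 : Fin 2) = 1 := h.injective (congrArg Subtype.val e : u = w)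
    simp at h01
  have : Fintype (h.linearIndepOn_id.extend (Set.subset_univ _)) :=
    FiniteDimensional.fintypeBasisIndex b
  have hcard : Fintype.card (h.linearIndepOn_id.extend (Set.subset_univ _)) = n := by
    have := finrank_eq_card_basis b
    rw [finrank_fin_fun] at this
    exact this.symm
  let e₀ := Fintype.equivFinOfCardEq hcard
  let z : Fin n := ⟨0, by omega⟩
  let o : Fin n := ⟨1, by omega⟩
  have hzo : z ≠ o := fun e => by simpa using congrArg Fin.val e
  let e₁ := e₀.trans (Equiv.swap (e₀ iu) z)
  have h1u : e₁ iu = z := by simp [e₁]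
  let e₂ := e₁.trans (Equiv.swap (e₁ iw) o)
  have h2w : e₂ iw = o := by simp [e₂]
  have h2u : e₂ iu = z := by
    have : e₁ iw ≠ z := fun e => hne (e₁.injective (h1u.trans e.symm))
    simp only [e₂, Equiv.trans_apply]
    rw [h1u, Equiv.swap_apply_of_ne_of_ne this.symm hzo]
  refine ⟨b.reindex e₂, fun i => ⟨fun hi => ?_, fun hi => ?_⟩⟩
  · have : e₂ iu = i := h2u.trans (Fin.ext hi.symm)
    rw [Basis.reindex_apply, ← this, Equiv.symm_apply_apply]
    exact Basis.extend_apply_self _ iu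
  · have : e₂ iw = i := h2w.trans (Fin.ext hi.symm)
    rw [Basis.reindex_apply, ← this, Equiv.symm_apply_apply]
    exact Basis.extend_apply_self _ iw

variable {F : Type*} [Field F] {R : Type*} [NonUnitalNonAssocRing R] [Module F R]
  [IsScalarTower F R R] [SMulCommClass F R R]

namespace IsFreeCentral

variable {c n : ℕ} {x : Fin n → R} (hx : IsFreeCentral F c x)

/-- Placing the variables of a c-element set into the shape t gives one nonzero element for each
set, and the support projections separate them. -/
theorem choose_le_finrank [FiniteDimensional F R] (hx : IsFreeCentral F c x) (hc : 1 ≤ c)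
    {t : FreeMagma (Fin c)} (ht : labels t = Finset.univ) (htl : t.length = c)
    (hne : ∀ ι : Fin c → Fin n, Function.Injective ι → FreeMagma.lift (x ∘ ι) t ≠ 0) :
    n.choose c ≤ finrank F (power F R c) := by
  let J := {S : Finset (Fin n) // S ∈ Finset.powersetCard c Finset.univ}
  have hJ : ∀ S : J, S.1.card = c := fun S => (Finset.mem_powersetCard.mp S.2).2
  let m : J → FreeMagma (Fin n) := fun S => FreeMagma.map (S.1.orderEmbOfFin (hJ S)) t
  have hm : ∀ S, labels (m S) = S.1 := by
    intro S
    rw [labels_map, ht, Finset.image_orderEmbOfFin_univ]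
  let y : J → power F R c := fun S => ⟨FreeMagma.lift x (m S),
    lift_mem_power x _ hc (by rw [length_map, htl])⟩
  have hy : LinearIndependent F y := by
    refine linearIndependent_of_separating
      (fun S : J => hx.suppProj S.1 ∘ₗ (power F R c).subtype) ?_ ?_
    · intro S T hST
      simp only [LinearMap.comp_apply, Submodule.subtype_apply, y]
      rw [suppProj_lift, hm, if_neg fun e => hST (Subtype.ext e.symm)]
    · intro S
      simp only [LinearMap.comp_apply, Submodule.subtype_apply, y]
      rw [suppProj_lift, hm, if_pos rfl, lift_map]
      exact hne _ (S.1.orderEmbOfFin (hJ S)).injective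
  have := hy.fintype_card_le_finrank
  simpa [J] using this

theorem exists_subst (hx : IsFreeCentral F c x) (f : (Fin n → F) →ₗ[F] (Fin n → F)) :
    ∃ φ : R →ₙₐ[F] R, ∀ v, φ (Fintype.linearCombination F x v) =
      Fintype.linearCombination F x (f v) := by
  classical
  obtain ⟨φ, hφ⟩ := hx.exists_hom fun i => Fintype.linearCombination F x (f (Pi.single i 1))
  refine ⟨φ, fun v => ?_⟩
  have : (φ : R →ₗ[F] R) ∘ₗ Fintype.linearCombination F x =
      Fintype.linearCombination F x ∘ₗ f := by
    refine LinearMap.pi_ext' fun i => LinearMap.ext_ring ?_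
    simp only [LinearMap.comp_apply, LinearMap.single_apply]
    rw [Fintype.linearCombination_apply_single, one_smul]
    exact hφ i
  exact LinearMap.congr_fun this v

/-- Endomorphisms that agree modulo `R ^ 2` on the generators agree modulo `R ^ 2`. -/
theorem sub_mem_power_two (hx : IsFreeCentral F c x) {Q : Type*} [NonUnitalNonAssocRing Q]
    [Module F Q] [IsScalarTower F Q Q] [SMulCommClass F Q Q] (φ ψ : R →ₙₐ[F] Q)
    (h : ∀ i, φ (x i) - ψ (x i) ∈ power F Q 2) (y : R) : φ y - ψ y ∈ power F Q 2 := by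
  have : (power F Q 2).mkQ ∘ₗ (φ : R →ₗ[F] Q) = (power F Q 2).mkQ ∘ₗ (ψ : R →ₗ[F] Q) := by
    refine hx.linearMap_ext fun m => ?_
    change (power F Q 2).mkQ (φ _) = (power F Q 2).mkQ (ψ _)
    rw [Submodule.mkQ_apply, Submodule.mkQ_apply, Submodule.Quotient.eq]
    induction m with
    | ih1 i => exact h i
    | ih2 m₁ m₂ _ _ =>
      rw [map_mul, map_mul, map_mul]
      exact sub_mem (mul_mem_power_two _ _) (mul_mem_power_two _ _)
  have h2 := LinearMap.congr_fun this y
  change (power F Q 2).mkQ (φ _) = (power F Q 2).mkQ (ψ _) at h2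
  rwa [Submodule.mkQ_apply, Submodule.mkQ_apply, Submodule.Quotient.eq] at h2

/-- On a product of l factors the two maps differ by an element of R^(l+1), by telescoping; for l =
c this is zero. Thus only linear parts matter on R^c. -/
theorem hom_eq_on_power (hx : IsFreeCentral F c x) (φ ψ : R →ₙₐ[F] R)
    (h : ∀ i, φ (x i) - ψ (x i) ∈ power F R 2) {y : R} (hy : y ∈ power F R c) : φ y = ψ y := by
  have key : ∀ m : FreeMagma R, φ (FreeMagma.lift id m) - ψ (FreeMagma.lift id m) ∈
      power F R (m.length + 1) := by
    intro m
    induction m with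
    | ih1 r => exact hx.sub_mem_power_two φ ψ h r
    | ih2 m₁ m₂ h₁ h₂ =>
      have hl : ((m₁ * m₂).length) = m₁.length + m₂.length := rfl
      rw [map_mul, map_mul, map_mul, hl]
      have e : φ (FreeMagma.lift id m₁) * φ (FreeMagma.lift id m₂) -
          ψ (FreeMagma.lift id m₁) * ψ (FreeMagma.lift id m₂) =
          (φ (FreeMagma.lift id m₁) - ψ (FreeMagma.lift id m₁)) * φ (FreeMagma.lift id m₂) +
          ψ (FreeMagma.lift id m₁) * (φ (FreeMagma.lift id m₂) - ψ (FreeMagma.lift id m₂)) := by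
        rw [sub_mul, mul_sub]; abel
      rw [e]
      refine add_mem ?_ ?_
      · rw [add_right_comm]
        exact mul_mem_power h₁ (hom_mem_power φ (lift_mem_power_length id m₂))
      · rw [add_assoc]
        exact mul_mem_power (hom_mem_power ψ (lift_mem_power_length id m₁)) h₂
  have hle : power F R c ≤ LinearMap.ker ((φ : R →ₗ[F] R) - (ψ : R →ₗ[F] R)) := by
    refine power_le fun m hm => ?_
    have := key m
    rw [hm, hx.power_succ_eq_bot, Submodule.mem_bot] at this
    exact this
  exact sub_eq_zero.mp (hle hy)

/-- A nonscalar linear substitution acts on `R ^ c` far from any scalar. -/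
theorem sub_le_finrank_range [FiniteDimensional F R] (hx : IsFreeCentral F c x) (hc : 2 ≤ c)
    {t : FreeMagma (Fin c)} (ht : labels t = Finset.univ) (htl : t.length = c)
    (hne : ∀ ι : Fin c → Fin n, Function.Injective ι → FreeMagma.lift (x ∘ ι) t ≠ 0)
    {f : (Fin n → F) →ₗ[F] (Fin n → F)} (hf : Function.Surjective f)
    (hns : ¬ ∃ r : F, f = r • 1) {φ : R →ₙₐ[F] R}
    (hφ : ∀ v, φ (Fintype.linearCombination F x v) = Fintype.linearCombination F x (f v))
    {T : power F R c →ₗ[F] power F R c} (hT : ∀ k, (T k : R) = φ k) (r : F) :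
    n - c ≤ finrank F (LinearMap.range (T - r • LinearMap.id)) := by
  classical
  obtain ⟨u, hu⟩ : ∃ u, LinearIndependent F ![u, f u] := by
    by_contra! h
    exact hns (LinearMap.exists_eq_smul_id_of_forall_notLinearIndependent h)
  obtain ⟨b, hb⟩ := exists_basis_extending_pair hu
  -- Preimages of the basis under f, with u chosen over the basis vector f u of index 1; u itself is
  -- the basis vector of index 0.
  obtain ⟨v, hv0, hv⟩ : ∃ v : Fin n → (Fin n → F), (∀ k : Fin n, (k : ℕ) = 1 → v k = u) ∧
      ∀ k, f (v k) = b k := by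
    choose g hg using hf
    refine ⟨fun k => if (k : ℕ) = 1 then u else g (b k), fun k hk => if_pos hk, fun k => ?_⟩
    by_cases hk : (k : ℕ) = 1
    · simp only [if_pos hk, (hb k).2 hk]
    · simp only [if_neg hk, hg]
  -- The index tuples (1, ..., c - 1, c + j): they avoid 0, start with 1 because c ≥ 2, and differ
  -- only in the last place.
  let idx : Fin (n - c) → Fin c → Fin n := fun j i =>
    if h : (i : ℕ) < c - 1 then ⟨(i : ℕ) + 1, by have := j.2; omega⟩
    else ⟨c + (j : ℕ), by have := j.2; omega⟩
  have hidx : ∀ j i, (idx j i : ℕ) = if (i : ℕ) < c - 1 then (i : ℕ) + 1 else c + (j : ℕ) := by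
    intro j i
    simp only [idx]
    split_ifs <;> rfl
  have hinj : ∀ j, Function.Injective (idx j) := by
    intro j i i' h
    have h' := congrArg Fin.val h
    rw [hidx, hidx] at h'
    ext
    split_ifs at h' <;> omega
  let g : Fin (n - c) → (Fin n → F) →ₗ[F] (Fin n → F) := fun j =>
    b.constr F fun k => if k ∈ Set.range (idx j) then Pi.single k 1 else 0
  have hg : ∀ j k, g j (b k) = if k ∈ Set.range (idx j) then Pi.single k 1 else 0 := fun j k =>
    b.constr_basis F _ k
  choose ψ hψ using fun j => hx.exists_subst (g j)
  let z : Fin (n - c) → power F R c := fun j =>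
    ⟨FreeMagma.lift (fun i => Fintype.linearCombination F x (v (idx j i))) t,
      lift_mem_power _ _ (by omega) htl.ge⟩
  -- The first factor of `z j'` comes from u, the basis vector of index 0, which `ψ j` kills. Hence
  -- the term with r disappears, and `ψ j` sees only the image of `z j'` under φ, which is nonzero
  -- precisely for j = j'.
  have hψz : ∀ j j', ψ j (z j') = 0 := by
    intro j j'
    simp only [z]
    rw [hom_lift]
    have h0 : (idx j' ⟨0, by omega⟩ : ℕ) = 1 := by
      rw [hidx, if_pos (by simp; omega)]
    refine lift_eq_zero (i := ⟨0, by omega⟩) (by rw [ht]; exact Finset.mem_univ _) ?_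
    have hn : 0 < n := by have := (idx j' ⟨0, by omega⟩).2; omega
    have hub : u = b ⟨0, hn⟩ := ((hb ⟨0, hn⟩).1 rfl).symm
    rw [hψ, hv0 _ h0, hub, hg, if_neg, map_zero]
    rintro ⟨i, hi⟩
    have := congrArg Fin.val hi
    rw [hidx] at this
    split_ifs at this
    simp at this
    omega
  have hφz : ∀ j j', ψ j (φ (z j')) =
      FreeMagma.lift (fun i => Fintype.linearCombination F x (g j (b (idx j' i)))) t := by
    intro j j'
    simp only [z]
    rw [hom_lift, hom_lift]
    simp only [hφ, hψ, hv]
  set N : power F R c →ₗ[F] power F R c := T - r • LinearMap.id with hN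
  have hy : LinearIndependent F fun j => (⟨N (z j), ⟨z j, rfl⟩⟩ : LinearMap.range N) := by
    have hval : ∀ j j', ψ j (N (z j') : R) =
        FreeMagma.lift (fun i => Fintype.linearCombination F x (g j (b (idx j' i)))) t := by
      intro j j'
      rw [hN, LinearMap.sub_apply, LinearMap.smul_apply, LinearMap.id_apply, Submodule.coe_sub,
        Submodule.coe_smul, hT, map_sub, map_smul, hψz, smul_zero, sub_zero, hφz]
    refine linearIndependent_of_separating (fun j => (ψ j : R →ₗ[F] R) ∘ₗ
      (power F R c).subtype ∘ₗ (LinearMap.range N).subtype) ?_ ?_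
    · intro j j' hjj'
      change ψ j _ = 0
      refine (hval j j').trans (lift_eq_zero (i := ⟨c - 1, by omega⟩)
        (by rw [ht]; exact Finset.mem_univ _) ?_)
      rw [hg, if_neg, map_zero]
      rintro ⟨i, hi⟩
      have := congrArg Fin.val hi
      rw [hidx, hidx, if_neg (lt_irrefl (c - 1))] at this
      apply hjj'
      ext
      split_ifs at this <;> omega
    · intro j
      change ψ j _ ≠ 0
      refine (hval j j).trans_ne ?_
      have : (fun i => Fintype.linearCombination F x (g j (b (idx j i)))) = x ∘ idx j := by
        funext i
        rw [hg, if_pos ⟨i, rfl⟩, Fintype.linearCombination_apply_single, one_smul]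
        rfl
      rw [this]
      exact hne _ (hinj j)
  have := hy.fintype_card_le_finrank
  simpa using this

end IsFreeCentral

end Rank

end NilpAlg
namespace NilpAlg

/-! ### The relatively free algebra: universal property, finiteness, nonzero monomials -/

section RelFreeAPI

open Module

universe u

theorem finite_freeMagma_length_le (α : Type*) [Finite α] (k : ℕ) :
    {m : FreeMagma α | m.length ≤ k}.Finite := by
  induction k with
  | zero =>
    refine Set.Finite.subset Set.finite_empty fun m hm => ?_
    have := m.length_pos
    exact absurd hm (not_le.mpr this)
  | succ k ih =>
    refine ((Set.finite_range (FreeMagma.of : α → _)).union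
      (Set.Finite.image2 (· * ·) ih ih)).subset fun m hm => ?_
    cases m with
    | of i => exact Or.inl ⟨i, rfl⟩
    | mul m₁ m₂ =>
      have h1 := m₁.length_pos
      have h2 := m₂.length_pos
      have h3 : m₁.length + m₂.length ≤ k + 1 := hm
      exact Or.inr ⟨m₁, show m₁.length ≤ k by omega, m₂, show m₂.length ≤ k by omega, rfl⟩

/-- The canonical projection as a homomorphism of algebras. -/
def projHom {F P : Type*} [Field F] [NonUnitalNonAssocRing P] [Module F P] (K : AlgIdeal F P) :
    P →ₙₐ[F] K.Quot where
  toFun := K.proj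
  map_smul' := fun r x => K.proj.map_smul r x
  map_zero' := K.proj.map_zero
  map_add' := K.proj.map_add
  map_mul' := K.proj_mul

theorem projHom_surjective {F P : Type*} [Field F] [NonUnitalNonAssocRing P] [Module F P]
    (K : AlgIdeal F P) : Function.Surjective (projHom K) := K.proj_surjective

theorem projHom_eq_zero {F P : Type*} [Field F] [NonUnitalNonAssocRing P] [Module F P]
    (K : AlgIdeal F P) {y : P} : projHom K y = 0 ↔ y ∈ K.toSubmodule := by
  have := K.proj_eq_proj (x := y) (y := 0)
  rw [sub_zero, map_zero] at this
  exact this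

/-- A homomorphism that vanishes on an ideal factors through the quotient. -/
theorem exists_factor {F P Q : Type*} [Field F] [NonUnitalNonAssocRing P] [Module F P]
    [NonUnitalNonAssocRing Q] [Module F Q] (K : AlgIdeal F P) (φ : P →ₙₐ[F] Q)
    (h : ∀ y ∈ K.toSubmodule, φ y = 0) : ∃ ψ : K.Quot →ₙₐ[F] Q, ∀ y, ψ (projHom K y) = φ y := by
  let l : K.Quot →ₗ[F] Q := K.toSubmodule.liftQ (φ : P →ₗ[F] Q) h
  have hl : ∀ y, l (projHom K y) = φ y := fun y => K.toSubmodule.liftQ_apply (φ : P →ₗ[F] Q) y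
  refine ⟨{ toFun := l, map_smul' := fun r x => l.map_smul r x, map_zero' := l.map_zero,
            map_add' := l.map_add, map_mul' := ?_ }, hl⟩
  intro a b
  obtain ⟨a, rfl⟩ := projHom_surjective K a
  obtain ⟨b, rfl⟩ := projHom_surjective K b
  rw [← map_mul, hl, hl, hl, map_mul]

variable {F : Type u} [Field F] (V : Set (FreeNonUnitalNonAssocAlgebra F ℕ)) (n : ℕ)

/-- The free generators of the relatively free algebra. -/
noncomputable def gen (i : Fin n) : RelFree V n := projHom _ (FreeNonUnitalNonAssocAlgebra.of F i)

theorem inClass_of_surjective {P Q : Type*} [NonUnitalNonAssocRing P] [Module F P]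
    [IsScalarTower F P P] [SMulCommClass F P P] [NonUnitalNonAssocRing Q] [Module F Q]
    [IsScalarTower F Q Q] [SMulCommClass F Q Q] (φ : P →ₙₐ[F] Q) (hφ : Function.Surjective φ)
    (h : ∀ w ∈ V, ∀ a : ℕ → P, φ (FreeNonUnitalNonAssocAlgebra.lift F a w) = 0) :
    InClass F Q V := by
  intro w hw a
  choose b hb using fun i => hφ (a i)
  have : FreeNonUnitalNonAssocAlgebra.lift F a =
      φ.comp (FreeNonUnitalNonAssocAlgebra.lift F b) := by
    refine FreeNonUnitalNonAssocAlgebra.hom_ext F ?_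
    intro i
    simp [hb]
  rw [this]
  exact h w hw b

theorem inClass_relFree : InClass F (RelFree V n) V :=
  inClass_of_surjective V (projHom _) (projHom_surjective _) fun w hw a =>
    (projHom_eq_zero _).mpr (VerbalMem.value w hw a)

theorem exists_hom_relFree {P : Type*} [NonUnitalNonAssocRing P] [Module F P]
    [IsScalarTower F P P] [SMulCommClass F P P] (hP : InClass F P V) (a : Fin n → P) :
    ∃ φ : RelFree V n →ₙₐ[F] P, ∀ i, φ (gen V n i) = a i := by
  obtain ⟨φ, hφ⟩ := exists_factor (verbalIdeal V (FreeNonUnitalNonAssocAlgebra F (Fin n)))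
    (FreeNonUnitalNonAssocAlgebra.lift F a) (by
      intro y hy
      change VerbalMem V _ y at hy
      induction hy with
      | value w hw b =>
        have : (FreeNonUnitalNonAssocAlgebra.lift F a).comp
            (FreeNonUnitalNonAssocAlgebra.lift F b) =
            FreeNonUnitalNonAssocAlgebra.lift F
              (fun i => FreeNonUnitalNonAssocAlgebra.lift F a (b i)) := by
          refine FreeNonUnitalNonAssocAlgebra.hom_ext F ?_
          intro i
          simp
        exact (DFunLike.congr_fun this w).trans (hP w hw _)
      | zero => exact map_zero _
      | add x y _ _ h1 h2 => rw [map_add, h1, h2, add_zero]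
      | smul r x _ h => rw [map_smul, h, smul_zero]
      | mul_left b x _ h => rw [map_mul, h, mul_zero]
      | mul_right b x _ h => rw [map_mul, h, zero_mul])
  refine ⟨φ, fun i => (hφ _).trans ?_⟩
  simp

theorem span_monomials_free (α : Type*) :
    Submodule.span F (Set.range (FreeMagma.lift (FreeNonUnitalNonAssocAlgebra.of F (X := α)))) =
      ⊤ := by
  let S : NonUnitalSubalgebra F (FreeNonUnitalNonAssocAlgebra F α) :=
    { Submodule.span F
        (Set.range (FreeMagma.lift (FreeNonUnitalNonAssocAlgebra.of F (X := α)))) with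
      mul_mem' := by
        intro x y hx hy
        refine Submodule.span_induction₂ (p := fun x y _ _ => x * y ∈ Submodule.span F
          (Set.range (FreeMagma.lift (FreeNonUnitalNonAssocAlgebra.of F (X := α)))))
          ?_ ?_ ?_ ?_ ?_ ?_ ?_ hx hy
        · rintro _ _ ⟨m, rfl⟩ ⟨m', rfl⟩
          exact Submodule.subset_span ⟨m * m', map_mul _ _ _⟩
        · intro y _; rw [zero_mul]; exact zero_mem _
        · intro y _; rw [mul_zero]; exact zero_mem _
        · intro x y z _ _ _ h1 h2; rw [add_mul]; exact add_mem h1 h2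
        · intro x y z _ _ _ h1 h2; rw [mul_add]; exact add_mem h1 h2
        · intro r x y _ _ h; rw [smul_mul_assoc]; exact Submodule.smul_mem _ _ h
        · intro r x y _ _ h; rw [mul_smul_comm]; exact Submodule.smul_mem _ _ h }
  have hS : ∀ i, FreeNonUnitalNonAssocAlgebra.of F i ∈ S := fun i =>
    Submodule.subset_span ⟨FreeMagma.of i, rfl⟩
  have hid : (NonUnitalSubalgebraClass.subtype S).comp (FreeNonUnitalNonAssocAlgebra.lift F
      (fun i => (⟨_, hS i⟩ : S))) = NonUnitalAlgHom.id F _ := by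
    refine FreeNonUnitalNonAssocAlgebra.hom_ext F ?_
    intro i
    simp
  rw [eq_top_iff]
  intro y _
  have := DFunLike.congr_fun hid y
  change ((FreeNonUnitalNonAssocAlgebra.lift F (fun i => (⟨_, hS i⟩ : S)) y : S) :
    FreeNonUnitalNonAssocAlgebra F α) = y at this
  rw [← this]
  exact SetLike.coe_mem (FreeNonUnitalNonAssocAlgebra.lift F (fun i => (⟨_, hS i⟩ : S)) y)

theorem span_monomials_relFree :
    Submodule.span F (Set.range (FreeMagma.lift (gen V n))) = ⊤ := by
  rw [eq_top_iff]
  intro y _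
  obtain ⟨y, rfl⟩ := projHom_surjective _ y
  have hy : y ∈ Submodule.span F
      (Set.range (FreeMagma.lift (FreeNonUnitalNonAssocAlgebra.of F (X := Fin n)))) := by
    rw [span_monomials_free]; trivial
  have h := Submodule.mem_map_of_mem
    (f := (verbalIdeal V (FreeNonUnitalNonAssocAlgebra F (Fin n))).proj) hy
  rw [Submodule.map_span] at h
  refine Submodule.span_mono ?_ h
  rintro _ ⟨_, ⟨m, rfl⟩, rfl⟩
  exact ⟨m, (hom_lift (projHom _) _ m).symm⟩

variable {V} {c : ℕ}

theorem power_succ_relFree (hnil : IsStepNilpotent V c) :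
    power F (RelFree V n) (c + 1) = ⊥ :=
  hnil.1 (Alg.mk (RelFree V n)) (inClass_relFree V n)

theorem finite_relFree [Finite F] (hnil : IsStepNilpotent V c) : Finite (RelFree V n) := by
  have hfin : (FreeMagma.lift (gen V n) '' {m | m.length ≤ c}).Finite :=
    (finite_freeMagma_length_le (Fin n) c).image _
  have htop : Submodule.span F (FreeMagma.lift (gen V n) '' {m | m.length ≤ c}) = ⊤ := by
    rw [eq_top_iff, ← span_monomials_relFree V n]
    refine Submodule.span_le.mpr ?_
    rintro _ ⟨m, rfl⟩
    by_cases hm : m.length ≤ c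
    · exact Submodule.subset_span ⟨m, hm, rfl⟩
    · have := lift_mem_power (F := F) (gen V n) m (i := c + 1) (by omega) (by omega)
      rw [power_succ_relFree n hnil, Submodule.mem_bot] at this
      rw [this]
      exact zero_mem _
  have : Module.Finite F (RelFree V n) := ⟨⟨hfin.toFinset, by simpa using htop⟩⟩
  exact Module.finite_of_finite F

theorem isFreeCentral_relFree (hnil : IsStepNilpotent V c) (hcentral : IsCentral V c)
    (hn : 2 ≤ n) : IsFreeCentral F c (gen V n) where
  span_eq_top := span_monomials_relFree V n
  exists_hom := exists_hom_relFree V n (inClass_relFree V n)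
  power_succ_eq_bot := power_succ_relFree n hnil
  annihilator_eq := hcentral n hn

/-- A nonzero product of c elements in some algebra of the class is a value of the monomial of the
same shape in c distinct variables, which therefore cannot vanish in the relatively free algebra. -/
theorem exists_nonzero_monomial (hnil : IsStepNilpotent V c) :
    ∃ t : FreeMagma (Fin c), labels t = Finset.univ ∧ t.length = c ∧
      ∀ (n : ℕ) (ι : Fin c → Fin n), Function.Injective ι →
        FreeMagma.lift (gen V n ∘ ι) t ≠ 0 := by
  obtain ⟨A, hA, hne⟩ := hnil.2
  obtain ⟨m, hm, hm0⟩ : ∃ m : FreeMagma A.carrier, m.length = c ∧ FreeMagma.lift id m ≠ 0 := by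
    by_contra! h
    refine hne (eq_bot_iff.mpr (power_le fun m hm => ?_))
    rw [h m hm]
    exact zero_mem _
  obtain ⟨t, a, hta, ht⟩ := exists_shape m hm
  refine ⟨t, ht, by rw [← length_map a t, hta, hm], fun n ι hι h0 => hm0 ?_⟩
  obtain ⟨φ, hφ⟩ := exists_hom_relFree V n hA (Function.extend ι a 0)
  have := hom_lift φ (gen V n ∘ ι) t
  rw [h0, map_zero] at this
  rw [← hta, lift_id_map, this]
  congr 2
  funext i
  rw [Function.comp_apply, hφ, hι.extend_apply]

/-- The generators are linearly independent modulo the square. -/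
theorem eq_zero_of_linearCombination_mem (hc : 1 ≤ c) (hnil : IsStepNilpotent V c) {n : ℕ}
    {v : Fin n → F} (hv : Fintype.linearCombination F (gen V n) v ∈ power F (RelFree V n) 2) :
    v = 0 := by
  classical
  by_contra hne
  obtain ⟨i, hi⟩ := Function.ne_iff.mp hne
  obtain ⟨A, hA, hAc⟩ := hnil.2
  -- Sending generator i to a and the others to 0 would give A = A², hence A = A^(c+1) = 0, against
  -- A^c ≠ 0.
  have h2 : ∀ a : A.carrier, a ∈ power F A.carrier 2 := by
    intro a
    obtain ⟨φ, hφ⟩ := exists_hom_relFree V n hA (Pi.single i a)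
    have h := hom_mem_power φ hv
    rw [Fintype.linearCombination_apply, map_sum, Finset.sum_eq_single i] at h
    · rw [map_smul, hφ, Pi.single_eq_same] at h
      exact (Submodule.smul_mem_iff _ hi).mp h
    · intro j _ hj
      rw [map_smul, hφ, Pi.single_eq_of_ne hj, smul_zero]
    · simp
  have hk : ∀ k, 1 ≤ k → ∀ a : A.carrier, a ∈ power F A.carrier k := by
    intro k hk
    induction k, hk using Nat.le_induction with
    | base => exact mem_power_one
    | succ k hk ih =>
      intro a
      have hle : power F A.carrier 2 ≤ power F A.carrier (k + 1) := by
        refine power_le fun m hm => ?_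
        cases m with
        | of x => exact absurd (show 1 = 2 from hm) (by decide)
        | mul m₁ m₂ =>
          have : FreeMagma.lift id (FreeMagma.mul m₁ m₂) =
            FreeMagma.lift id m₁ * FreeMagma.lift id m₂ := map_mul _ m₁ m₂
          rw [this]
          exact mul_mem_power (ih _) (mem_power_one _)
      exact hle (h2 a)
  refine hAc (eq_bot_iff.mpr fun a _ => ?_)
  have := hk (c + 1) (by omega) a
  rwa [hnil.1 A hA] at this

end RelFreeAPI

end NilpAlg
namespace NilpAlg

/-! ### Endomorphisms of R and their linear parts -/

section LinearPart

open Module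

namespace IsFreeCentral

variable {F : Type*} [Field F] {R : Type*} [NonUnitalNonAssocRing R] [Module F R]
  [IsScalarTower F R R] [SMulCommClass F R R] {c n : ℕ} {x : Fin n → R}

theorem hom_ext (hx : IsFreeCentral F c x) {Q : Type*} [NonUnitalNonAssocRing Q] [Module F Q]
    {φ ψ : R →ₙₐ[F] Q} (h : ∀ i, φ (x i) = ψ (x i)) (y : R) : φ y = ψ y := by
  have : (φ : R →ₗ[F] Q) = (ψ : R →ₗ[F] Q) := by
    refine hx.linearMap_ext fun m => ?_
    change φ _ = ψ _
    rw [hom_lift, hom_lift]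
    exact lift_congr (m := m) fun i _ => h i
  exact LinearMap.congr_fun this y

/-- Homomorphisms between quotients lift to `R`. -/
theorem exists_lift (hx : IsFreeCentral F c x) {P Q : Type*} [NonUnitalNonAssocRing P]
    [Module F P] [NonUnitalNonAssocRing Q] [Module F Q] (π : R →ₙₐ[F] P) {π' : R →ₙₐ[F] Q}
    (hπ' : Function.Surjective π') (θ : P →ₙₐ[F] Q) :
    ∃ ψ : R →ₙₐ[F] R, ∀ y, π' (ψ y) = θ (π y) := by
  choose b hb using fun i => hπ' (θ (π (x i)))
  obtain ⟨ψ, hψ⟩ := hx.exists_hom b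
  exact ⟨ψ, hx.hom_ext (φ := π'.comp ψ) (ψ := θ.comp π) fun i => by simp [hψ, hb]⟩

theorem exists_linear_part (hx : IsFreeCentral F c x) (y : R) :
    ∃ v, y - Fintype.linearCombination F x v ∈ power F R 2 := by
  classical
  have hy : y ∈ Submodule.span F (Set.range (FreeMagma.lift x)) := by
    rw [hx.span_eq_top]; trivial
  refine Submodule.span_induction
    (p := fun y _ => ∃ v, y - Fintype.linearCombination F x v ∈ power F R 2) ?_ ?_ ?_ ?_ hy
  · rintro _ ⟨m, rfl⟩
    induction m with
    | ih1 i =>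
      refine ⟨Pi.single i 1, ?_⟩
      rw [Fintype.linearCombination_apply_single, one_smul, FreeMagma.lift_of, sub_self]
      exact zero_mem _
    | ih2 m₁ m₂ _ _ =>
      refine ⟨0, ?_⟩
      rw [map_zero, sub_zero, map_mul]
      exact mul_mem_power_two _ _
  · exact ⟨0, by simp⟩
  · rintro y z _ _ ⟨v, hv⟩ ⟨w, hw⟩
    refine ⟨v + w, ?_⟩
    rw [map_add, add_sub_add_comm]
    exact add_mem hv hw
  · rintro r y _ ⟨v, hv⟩
    refine ⟨r • v, ?_⟩
    rw [map_smul, ← smul_sub]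
    exact Submodule.smul_mem _ _ hv

/-- The endomorphism given by a linear substitution of the generators. -/
noncomputable def subst (hx : IsFreeCentral F c x) (f : (Fin n → F) →ₗ[F] (Fin n → F)) :
    R →ₙₐ[F] R := (hx.exists_subst f).choose

theorem subst_linearCombination (hx : IsFreeCentral F c x) (f : (Fin n → F) →ₗ[F] (Fin n → F))
    (v : Fin n → F) : hx.subst f (Fintype.linearCombination F x v) =
      Fintype.linearCombination F x (f v) :=
  (hx.exists_subst f).choose_spec v

theorem subst_gen (hx : IsFreeCentral F c x) [DecidableEq (Fin n)]
    (f : (Fin n → F) →ₗ[F] (Fin n → F)) (i : Fin n) : hx.subst f (x i) =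
      Fintype.linearCombination F x (f (Pi.single i 1)) := by
  rw [← subst_linearCombination, Fintype.linearCombination_apply_single, one_smul]

/-- Every endomorphism is a linear substitution modulo `R ^ 2`. -/
theorem exists_sub_subst_mem (hx : IsFreeCentral F c x) (ψ : R →ₙₐ[F] R) :
    ∃ f : (Fin n → F) →ₗ[F] (Fin n → F), ∀ i, ψ (x i) - hx.subst f (x i) ∈ power F R 2 := by
  classical
  choose a ha using fun i => hx.exists_linear_part (ψ (x i))
  refine ⟨Fintype.linearCombination F a, fun i => ?_⟩
  rw [subst_gen, Fintype.linearCombination_apply_single, one_smul]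
  exact ha i

/-- Modulo R² the endomorphism is the matrix f, the generators being independent there, so
surjectivity modulo R² passes to f. -/
theorem surjective_of_surjective_mod (hx : IsFreeCentral F c x)
    (hind : ∀ v, Fintype.linearCombination F x v ∈ power F R 2 → v = 0) {ψ : R →ₙₐ[F] R}
    {f : (Fin n → F) →ₗ[F] (Fin n → F)}
    (hf : ∀ i, ψ (x i) - hx.subst f (x i) ∈ power F R 2)
    (hψ : ∀ y, ∃ z, y - ψ z ∈ power F R 2) : Function.Surjective f := by
  intro w
  obtain ⟨z, hz⟩ := hψ (Fintype.linearCombination F x w)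
  obtain ⟨v, hv⟩ := hx.exists_linear_part z
  refine ⟨v, (sub_eq_zero.mp (hind _ ?_)).symm⟩
  have h1 := hom_mem_power ψ hv
  have h2 := hx.sub_mem_power_two _ _ hf (Fintype.linearCombination F x v)
  rw [subst_linearCombination] at h2
  rw [map_sub] at h1 ⊢
  have := add_mem (add_mem hz h1) h2
  convert this using 1
  abel

theorem subst_sub_smul_mem (hx : IsFreeCentral F c x) (r : F) (y : R) :
    hx.subst (r • 1) y - r • y ∈ power F R 2 := by
  obtain ⟨v, hv⟩ := hx.exists_linear_part y
  have h1 := hom_mem_power (hx.subst (r • 1)) hv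
  have h2 := Submodule.smul_mem _ r hv
  have h3 : hx.subst (r • 1) (Fintype.linearCombination F x v) =
      r • Fintype.linearCombination F x v := by
    rw [subst_linearCombination, LinearMap.smul_apply, Module.End.one_apply, map_smul]
  rw [map_sub, h3] at h1
  rw [smul_sub] at h2
  have := sub_mem h1 h2
  convert this using 1
  abel

end IsFreeCentral

end LinearPart

/-! ### Isomorphism classes as classes of ideals of R -/

section IdealClasses

open Module

universe u

variable {F : Type u} [Field F] {V : Set (FreeNonUnitalNonAssocAlgebra F ℕ)} {n : ℕ}

/-- A subspace that is a two-sided ideal. -/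
def IsIdeal {R : Type*} [NonUnitalNonAssocRing R] [Module F R] (K : Submodule F R) : Prop :=
  ∀ a y : R, y ∈ K → a * y ∈ K ∧ y * a ∈ K

/-- A two-sided ideal, as an `AlgIdeal`. -/
def IsIdeal.toAlgIdeal {R : Type*} [NonUnitalNonAssocRing R] [Module F R] {K : Submodule F R}
    (h : IsIdeal K) : AlgIdeal F R where
  toSubmodule := K
  mul_mem_left a _ hy := (h a _ hy).1
  mul_mem_right a _ hy := (h a _ hy).2

theorem isIdeal_ker {R P : Type*} [NonUnitalNonAssocRing R] [Module F R]
    [NonUnitalNonAssocRing P] [Module F P] (π : R →ₙₐ[F] P) :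
    IsIdeal (LinearMap.ker (π : R →ₗ[F] P)) := by
  intro a y hy
  replace hy : π y = 0 := hy
  exact ⟨show π (a * y) = 0 by rw [map_mul, hy, mul_zero],
    show π (y * a) = 0 by rw [map_mul, hy, zero_mul]⟩

theorem isGeneratedBy_of_surjective {P : Type*} [NonUnitalNonAssocRing P] [Module F P]
    [IsScalarTower F P P] [SMulCommClass F P P] (π : RelFree V n →ₙₐ[F] P)
    (hπ : Function.Surjective π) : IsGeneratedBy F P n := by
  refine ⟨fun i => π (gen V n i), eq_top_iff.mpr fun y _ => ?_⟩
  obtain ⟨y, rfl⟩ := hπ y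
  have hy : y ∈ Submodule.span F (Set.range (FreeMagma.lift (gen V n))) := by
    rw [span_monomials_relFree]; trivial
  refine Submodule.span_induction (p := fun y _ => π y ∈ NonUnitalAlgebra.adjoin F
    (Set.range fun i => π (gen V n i))) ?_ ?_ ?_ ?_ hy
  · rintro _ ⟨m, rfl⟩
    induction m with
    | ih1 i => exact NonUnitalAlgebra.subset_adjoin F ⟨i, rfl⟩
    | ih2 m₁ m₂ h₁ h₂ =>
      rw [map_mul, map_mul]
      exact mul_mem h₁ h₂
  · rw [map_zero]; exact zero_mem _
  · intro y z _ _ h1 h2; rw [map_add]; exact add_mem h1 h2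
  · intro r y _ h; rw [map_smul]; exact SMulMemClass.smul_mem r h

theorem exists_surjective_of_isGeneratedBy {P : Type*} [NonUnitalNonAssocRing P] [Module F P]
    [IsScalarTower F P P] [SMulCommClass F P P] (hP : InClass F P V) (hg : IsGeneratedBy F P n) :
    ∃ π : RelFree V n →ₙₐ[F] P, Function.Surjective π := by
  obtain ⟨a, ha⟩ := hg
  obtain ⟨π, hπ⟩ := exists_hom_relFree V n hP a
  refine ⟨π, fun y => ?_⟩
  have hle : NonUnitalAlgebra.adjoin F (Set.range a) ≤ NonUnitalAlgHom.range π := by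
    refine NonUnitalAlgebra.adjoin_le ?_
    rintro _ ⟨i, rfl⟩
    exact ⟨gen V n i, hπ i⟩
  have hy : y ∈ NonUnitalAlgHom.range π := hle (by rw [ha]; trivial)
  exact hy

/-- The quotient of the relatively free algebra by an ideal. -/
noncomputable def quotAlg {K : Submodule F (RelFree V n)} (h : IsIdeal K) : GenAlg V n :=
  ⟨Alg.mk h.toAlgIdeal.Quot,
    inClass_of_surjective V (projHom h.toAlgIdeal) (projHom_surjective _) fun w hw a => by
      rw [inClass_relFree V n w hw a, map_zero],
    isGeneratedBy_of_surjective (projHom h.toAlgIdeal) (projHom_surjective _)⟩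

/-- The isomorphism class of the quotient by an ideal. -/
noncomputable def idealClass {K : Submodule F (RelFree V n)} (h : IsIdeal K) : IsoClasses V n :=
  Quotient.mk (genSetoid V n) (quotAlg h)

theorem idealClass_ker (A : GenAlg V n) {π : RelFree V n →ₙₐ[F] A.1.carrier}
    (hπ : Function.Surjective π) :
    idealClass (isIdeal_ker π) = Quotient.mk (genSetoid V n) A := by
  refine Quotient.sound ?_
  obtain ⟨ψ, hψ⟩ := exists_factor (isIdeal_ker π).toAlgIdeal π fun y hy => hy
  refine ⟨ψ, (injective_iff_map_eq_zero ψ).mpr ?_, ?_⟩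
  · intro a ha
    obtain ⟨y, rfl⟩ := projHom_surjective _ a
    rw [hψ] at ha
    exact (projHom_eq_zero _).mpr ha
  · intro p
    obtain ⟨y, rfl⟩ := hπ p
    exact ⟨projHom _ y, hψ y⟩

theorem exists_idealClass (z : IsoClasses V n) :
    ∃ (K : Submodule F (RelFree V n)) (h : IsIdeal K), idealClass h = z := by
  obtain ⟨A, rfl⟩ := Quotient.exists_rep z
  obtain ⟨π, hπ⟩ := exists_surjective_of_isGeneratedBy A.2.1 A.2.2
  exact ⟨_, isIdeal_ker π, idealClass_ker A hπ⟩

theorem finite_isoClasses [Finite F] {c : ℕ} (hnil : IsStepNilpotent V c) :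
    Finite (IsoClasses V n) := by
  have := finite_relFree n hnil
  refine Finite.of_surjective
    (fun K : {K : Submodule F (RelFree V n) // IsIdeal K} => idealClass K.2) fun z => ?_
  obtain ⟨K, h, rfl⟩ := exists_idealClass z
  exact ⟨⟨K, h⟩, rfl⟩

variable {c : ℕ}

/-- Lift the isomorphism of quotients to R and replace the lift by its linear part, which agrees
with it on R^c. Invertibility of f is not needed: the equivalence recovers K ∩ R^c from K' and f. -/
theorem exists_subst_of_idealClass_eq (hx : IsFreeCentral F c (gen V n))
    {K K' : Submodule F (RelFree V n)} (h : IsIdeal K) (h' : IsIdeal K')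
    (he : idealClass h = idealClass h') :
    ∃ f, ∀ y ∈ power F (RelFree V n) c, y ∈ K ↔ hx.subst f y ∈ K' := by
  obtain ⟨θ, hθ⟩ := Quotient.exact he
  obtain ⟨ψ, hψ⟩ := hx.exists_lift (projHom h.toAlgIdeal) (projHom_surjective h'.toAlgIdeal) θ
  obtain ⟨f, hf⟩ := hx.exists_sub_subst_mem ψ
  refine ⟨f, fun y hy => ?_⟩
  rw [← hx.hom_eq_on_power _ _ hf hy]
  have h1 : y ∈ K ↔ projHom h.toAlgIdeal y = 0 := (projHom_eq_zero h.toAlgIdeal).symm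
  have h2 : ψ y ∈ K' ↔ projHom h'.toAlgIdeal (ψ y) = 0 := (projHom_eq_zero h'.toAlgIdeal).symm
  rw [h1, h2, hψ]
  exact ((injective_iff_map_eq_zero' θ).mp hθ.injective _).symm

/-- Take the kernel K of a presentation. If K ⊆ R^c ⊆ R², the automorphism and its lift have the
same action modulo squares, so the linear part f is surjective and nonscalar, and on K it coincides
with the lift, which preserves K. -/
theorem exists_of_mem_nonScalarClasses (hc : 2 ≤ c) (hnil : IsStepNilpotent V c)
    (hx : IsFreeCentral F c (gen V n)) {z : IsoClasses V n} (hz : z ∈ nonScalarClasses V n) :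
    ∃ (K : Submodule F (RelFree V n)) (h : IsIdeal K), idealClass h = z ∧
      (¬ K ≤ power F (RelFree V n) c ∨ K ≤ power F (RelFree V n) c ∧
        ∃ f : (Fin n → F) →ₗ[F] (Fin n → F), Function.Surjective f ∧ (¬ ∃ r : F, f = r • 1) ∧
          ∀ k ∈ K, hx.subst f k ∈ K) := by
  obtain ⟨A, rfl, δ, hδ, hns⟩ := hz
  obtain ⟨π, hπ⟩ := exists_surjective_of_isGeneratedBy A.2.1 A.2.2
  refine ⟨_, isIdeal_ker π, idealClass_ker A hπ, ?_⟩
  by_cases hK : LinearMap.ker (π : RelFree V n →ₗ[F] A.1.carrier) ≤ power F (RelFree V n) c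
  swap
  · exact Or.inl hK
  refine Or.inr ⟨hK, ?_⟩
  obtain ⟨ψ, hψ⟩ := hx.exists_lift π hπ δ
  obtain ⟨f, hf⟩ := hx.exists_sub_subst_mem ψ
  refine ⟨f, ?_, ?_, ?_⟩
  · refine hx.surjective_of_surjective_mod
      (fun v hv => eq_zero_of_linearCombination_mem (by omega) hnil hv) hf fun y => ?_
    obtain ⟨p, hp⟩ := hδ.2 (π y)
    obtain ⟨w, rfl⟩ := hπ p
    refine ⟨w, power_antitone (by omega) hc (hK ?_)⟩
    change π (y - ψ w) = 0
    rw [map_sub, hψ, hp, sub_self]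
  · rintro ⟨r, rfl⟩
    refine hns ⟨r, fun p => ?_⟩
    obtain ⟨y, rfl⟩ := hπ p
    have h1 := add_mem (hx.sub_mem_power_two _ _ hf y) (hx.subst_sub_smul_mem r y)
    rw [sub_add_sub_cancel] at h1
    have h2 := hom_mem_power π h1
    rwa [map_sub, hψ, map_smul] at h2
  · intro k hk
    rw [← hx.hom_eq_on_power _ _ hf (hK hk)]
    change π (ψ k) = 0
    rw [hψ, show π k = 0 from hk, map_zero]

end IdealClasses

end NilpAlg
namespace NilpAlg

/-! ### Bounds for the two kinds of exceptional ideals -/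

section Estimates

open Module

variable {F : Type*} [Field F] {R : Type*} [NonUnitalNonAssocRing R] [Module F R]
  [IsScalarTower F R R] [SMulCommClass F R R] {c n : ℕ} {x : Fin n → R}

theorem choose_two_le_choose (hc : 2 ≤ c) (hcn : 2 * c ≤ n) : n.choose 2 ≤ n.choose c := by
  induction c, hc using Nat.le_induction with
  | base => exact le_rfl
  | succ k hk ih =>
    exact (ih (by omega)).trans (Nat.choose_le_succ_of_lt_half_left (by omega))

variable [FiniteDimensional F R]

theorem finrank_map_mkQ_add {F R : Type*} [Field F] [AddCommGroup R] [Module F R]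
    [FiniteDimensional F R] (K C : Submodule F R) :
    finrank F (K.map C.mkQ) + finrank F ↥(K ⊓ C) = finrank F K := by
  have := finrank_inf_ker_add_finrank_map K C.mkQ
  rw [Submodule.ker_mkQ] at this
  omega

/-- The ideals with a given image in `R / R ^ c` lie in a small interval. -/
theorem ncard_ideals_with_image_le [Finite F] [Finite R] (hx : IsFreeCentral F c x) (hc : 1 ≤ c)
    (hn : 83 * c ≤ n) (L : Submodule F (R ⧸ power F R c)) :
    {K : Submodule F R | IsIdeal K ∧ K.map (power F R c).mkQ = L}.ncard ≤
      Nat.card F ^ subspaceExp (finrank F (power F R c) - 40 * finrank F L) := by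
  -- Q = K + R^c for each K counted. As R^c annihilates R, the products of K with R are those of Q;
  -- so their span P depends only on L, and P ≤ K ≤ Q.
  obtain ⟨Q, hQ0⟩ : ∃ Q : Submodule F R, Q = L.comap (power F R c).mkQ := ⟨_, rfl⟩
  let P : Submodule F R := Submodule.span F {y | ∃ u ∈ Q, ∃ a, y = u * a ∨ y = a * u}
  have hQL : Q.map (power F R c).mkQ = L := by
    rw [hQ0]
    exact Submodule.map_comap_eq_self (by rw [Submodule.range_mkQ]; exact le_top)
  have hP : (n - c) * finrank F L ≤ 2 * c * finrank F P := by
    have := hx.expansion hc (U := Q) (M := P) fun u hu a =>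
      ⟨Submodule.subset_span ⟨u, hu, a, Or.inl rfl⟩, Submodule.subset_span ⟨u, hu, a, Or.inr rfl⟩⟩
    rwa [hQL] at this
  -- n ≥ 83c gives n - c ≥ 82c, hence the factor 41; one dim L is lost in dim Q, leaving the 40 of
  -- the statement.
  have hP' : 41 * finrank F L ≤ finrank F P := by
    have h1 : 2 * c * (41 * finrank F L) ≤ 2 * c * finrank F P := by
      refine le_trans ?_ hP
      calc 2 * c * (41 * finrank F L) = (82 * c) * finrank F L := by ring
        _ ≤ _ := Nat.mul_le_mul_right _ (by omega)
    exact Nat.le_of_mul_le_mul_left h1 (by omega)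
  have hQ : finrank F Q ≤ finrank F L + finrank F (power F R c) := by
    have h1 := finrank_map_mkQ_add Q (power F R c)
    have h2 : finrank F ↥(Q ⊓ power F R c) ≤ finrank F (power F R c) := Submodule.finrank_mono inf_le_right
    rw [hQL] at h1
    omega
  refine le_trans (Set.ncard_le_ncard ?_) (ncard_between_le P Q (by omega))
  rintro K ⟨hK, hKL⟩
  refine ⟨Submodule.span_le.mpr ?_, hQ0 ▸ hKL ▸ Submodule.le_comap_map _ _⟩
  rintro _ ⟨u, hu, a, ha⟩
  rw [hQ0, ← hKL] at hu
  obtain ⟨k, hk, hku⟩ := hu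
  have hd : u - k ∈ power F R c := (Submodule.Quotient.eq (power F R c)).mp hku.symm
  obtain ⟨h1, h2⟩ := mul_eq_zero_of_mem_power hx.power_succ_eq_bot hd a
  rw [sub_mul, sub_eq_zero] at h1
  rw [mul_sub, sub_eq_zero] at h2
  rcases ha with rfl | rfl
  · rw [h1]; exact (hK a k hk).2
  · rw [h2]; exact (hK a k hk).1

/-- Expansion applied to the whole algebra; the constant 8 is far from sharp but enough for the
choice of the image L in R/R^c to be cheap. -/
theorem finrank_quotient_le (hx : IsFreeCentral F c x) (hc : 1 ≤ c) (hn : 83 * c ≤ n) :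
    8 * finrank F (R ⧸ power F R c) ≤ finrank F (power F R c) := by
  have h := hx.expansion hc (U := ⊤) (M := ⊤) fun u _ a => ⟨trivial, trivial⟩
  have h1 : (⊤ : Submodule F R).map (power F R c).mkQ = ⊤ := by
    rw [Submodule.map_top, Submodule.range_mkQ]
  rw [h1, finrank_top, finrank_top,
    ← Submodule.finrank_quotient_add_finrank (power F R c)] at h
  generalize finrank F (R ⧸ power F R c) = E at *
  generalize finrank F (power F R c) = D at *
  have h2 : 82 * c * E ≤ 2 * c * (E + D) := (Nat.mul_le_mul_right _ (by omega)).trans h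
  have h3 : 2 * c * (41 * E) ≤ 2 * c * (E + D) := by linarith
  have := Nat.le_of_mul_le_mul_left h3 (by omega)
  omega

/-- The choice of an l-dimensional image costs E l ≤ D l/8, while shortening the interval by 40 l
saves at least 40 D l in the quadruple exponent as long as 40 l ≤ D; beyond that the interval is
trivial. -/
theorem exponent_le {D E l : ℕ} (hl : 1 ≤ l) (hlE : l ≤ E) (hE : 8 * E ≤ D) (hD : 100 ≤ D) :
    4 * (E * l + subspaceExp (D - 40 * l)) + 33 * D ≤ D * D + 1 := by
  have h1 : 4 * subspaceExp (D - 40 * l) ≤ (D - 40 * l) * (D - 40 * l) + 6 * (D - 40 * l) + 1 := by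
    unfold subspaceExp
    exact Nat.mul_div_le _ _
  have h2 : 8 * (E * l) ≤ D * l := by
    rw [← mul_assoc]; exact Nat.mul_le_mul_right _ hE
  rcases le_total (40 * l) D with h | h
  · obtain ⟨m, hm⟩ := Nat.exists_eq_add_of_le h
    have hm' : D - 40 * l = m := by omega
    rw [hm'] at h1 ⊢
    nlinarith
  · have h0 : D - 40 * l = 0 := by omega
    rw [h0] at h1 ⊢
    have h3 : E * l ≤ E * E := Nat.mul_le_mul_left _ hlE
    nlinarith

/-- Most ideals lie in `R ^ c`. -/
theorem ncard_ideals_not_le [Finite F] [Finite R] (hx : IsFreeCentral F c x) (hc : 1 ≤ c)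
    (hn : 83 * c ≤ n) (hD : 100 ≤ finrank F (power F R c)) {e : ℕ}
    (he : finrank F (power F R c) * finrank F (power F R c) + 1 ≤
      4 * e + 32 * finrank F (power F R c)) :
    {K : Submodule F R | IsIdeal K ∧ ¬ K ≤ power F R c}.ncard ≤ Nat.card F ^ e := by
  set C := power F R c with hC
  set D := finrank F C with hDdef
  have hE := finrank_quotient_le hx hc hn
  rw [← hC, ← hDdef] at hE
  set E := finrank F (R ⧸ C) with hEdef
  have : Finite (R ⧸ C) := Finite.of_surjective _ C.mkQ_surjective
  have := Fintype.ofFinite (Submodule F (R ⧸ C))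
  have hl : ∀ l ∈ Finset.Icc 1 E,
      {K : Submodule F R | IsIdeal K ∧ finrank F (K.map C.mkQ) = l}.ncard ≤
        Nat.card F ^ (e - E) := by
    intro l hl
    obtain ⟨hl1, hl2⟩ := Finset.mem_Icc.mp hl
    have hsub : {K : Submodule F R | IsIdeal K ∧ finrank F (K.map C.mkQ) = l} ⊆
        ⋃ L ∈ {L : Submodule F (R ⧸ C) | finrank F L = l}.toFinset,
          {K : Submodule F R | IsIdeal K ∧ K.map C.mkQ = L} := by
      rintro K ⟨hK, hKl⟩
      simp only [Set.mem_iUnion, exists_prop, Set.mem_toFinset]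
      exact ⟨K.map C.mkQ, hKl, hK, rfl⟩
    calc _ ≤ _ := Set.ncard_le_ncard hsub
      _ ≤ _ := Finset.set_ncard_biUnion_le _ _
      _ ≤ ∑ L ∈ {L : Submodule F (R ⧸ C) | finrank F L = l}.toFinset,
          Nat.card F ^ subspaceExp (D - 40 * l) := by
        refine Finset.sum_le_sum fun L hL => ?_
        have hL' : finrank F L = l := by simpa using hL
        have := ncard_ideals_with_image_le hx hc hn L
        rwa [hL'] at this
      _ = {L : Submodule F (R ⧸ C) | finrank F L = l}.ncard *
          Nat.card F ^ subspaceExp (D - 40 * l) := by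
        rw [Finset.sum_const, smul_eq_mul, Set.ncard_eq_toFinset_card']
      _ ≤ Nat.card F ^ (E * l) * Nat.card F ^ subspaceExp (D - 40 * l) := by
        refine Nat.mul_le_mul_right _ ((ncard_finrank_eq_le' l).trans
          (Nat.pow_le_pow_right Nat.card_pos (Nat.mul_le_mul_right _ ?_)))
        rw [← hEdef]
        omega
      _ = Nat.card F ^ (E * l + subspaceExp (D - 40 * l)) := (pow_add _ _ _).symm
      _ ≤ _ := by
        refine Nat.pow_le_pow_right Nat.card_pos ?_
        have := exponent_le hl1 hl2 hE hD
        omega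
  have hsub : {K : Submodule F R | IsIdeal K ∧ ¬ K ≤ C} ⊆
      ⋃ l ∈ Finset.Icc 1 E, {K : Submodule F R | IsIdeal K ∧ finrank F (K.map C.mkQ) = l} := by
    rintro K ⟨hK, hKC⟩
    simp only [Set.mem_iUnion, exists_prop]
    refine ⟨finrank F (K.map C.mkQ), Finset.mem_Icc.mpr ⟨?_, Submodule.finrank_le _⟩, hK, rfl⟩
    rw [Nat.one_le_iff_ne_zero, Ne, Submodule.finrank_eq_zero, ← LinearMap.le_ker_iff_map,
      Submodule.ker_mkQ]
    exact hKC
  calc _ ≤ _ := Set.ncard_le_ncard hsub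
    _ ≤ _ := Finset.set_ncard_biUnion_le _ _
    _ ≤ ∑ l ∈ Finset.Icc 1 E, Nat.card F ^ (e - E) := Finset.sum_le_sum hl
    _ = E * Nat.card F ^ (e - E) := by simp
    _ ≤ Nat.card F ^ E * Nat.card F ^ (e - E) :=
      Nat.mul_le_mul_right _ ((Nat.le_succ E).trans (succ_le_card_pow F E))
    _ = Nat.card F ^ e := by
      rw [← pow_add]
      congr 1
      have : E ≤ e := by nlinarith
      omega

/-- Few subspaces of `R ^ c` are invariant under a nonscalar substitution. -/
theorem ncard_subst_invariant_le [Finite F] [Finite R] (hx : IsFreeCentral F c x) (hc : 2 ≤ c)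
    {t : FreeMagma (Fin c)} (ht : labels t = Finset.univ) (htl : t.length = c)
    (hne : ∀ ι : Fin c → Fin n, Function.Injective ι → FreeMagma.lift (x ∘ ι) t ≠ 0)
    (hn : 83 * c ≤ n) (hD : 1000 ≤ finrank F (power F R c))
    {f : (Fin n → F) →ₗ[F] (Fin n → F)} (hf : Function.Surjective f)
    (hns : ¬ ∃ r : F, f = r • 1) {e : ℕ}
    (he : finrank F (power F R c) * finrank F (power F R c) + 2 ≤
      4 * e + 70 * finrank F (power F R c)) :
    {K : Submodule F R | K ≤ power F R c ∧ ∀ k ∈ K, hx.subst f k ∈ K}.ncard ≤ Nat.card F ^ e := by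
  set C := power F R c with hC
  set D := finrank F C with hDdef
  let T : C →ₗ[F] C := (hx.subst f : R →ₗ[F] R).restrict fun k hk => hom_mem_power (hx.subst f) hk
  have hT : ∀ k, (T k : R) = hx.subst f k := fun k => rfl
  have hle : {K : Submodule F R | K ≤ C ∧ ∀ k ∈ K, hx.subst f k ∈ K}.ncard ≤
      {S : Submodule F C | S ≤ S.comap T}.ncard := by
    refine Set.ncard_le_ncard_of_injOn (fun K => K.comap C.subtype) ?_ ?_
    · rintro K ⟨-, hK⟩ k hk
      exact hK _ hk
    · rintro K ⟨hK, -⟩ K' ⟨hK', -⟩ h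
      have := congrArg (Submodule.map C.subtype) h
      simpa [Submodule.map_comap_subtype, inf_eq_right.mpr hK, inf_eq_right.mpr hK'] using this
  refine hle.trans ?_
  by_cases hν : ∀ r : F, 4 * finrank F (LinearMap.ker (T - r • LinearMap.id)) ≤ finrank F C
  · refine (ncard_invariant_le_of_small_eigenspaces T hν).trans
      (Nat.pow_le_pow_right Nat.card_pos ?_)
    rw [← hDdef]
    have h1 : 128 * ((5 * D + 16) ^ 2 / 128) ≤ (5 * D + 16) ^ 2 := Nat.mul_div_le _ _
    nlinarith
  · push Not at hν
    obtain ⟨r, hr⟩ := hν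
    -- Subtracting the eigenvalue r preserves invariance and makes the kernel larger than D/4, so
    -- that the count by range and kernel applies.
    have h1 : {S : Submodule F C | S ≤ S.comap T} ⊆
        {S : Submodule F C | S ≤ S.comap (T - r • LinearMap.id)} := by
      intro S hS k hk
      exact S.sub_mem (show T k ∈ S from hS hk) (S.smul_mem r hk)
    refine (Set.ncard_le_ncard h1).trans ((ncard_invariant_le _).trans
      (Nat.pow_le_pow_right Nat.card_pos ?_))
    have h2 := hx.sub_le_finrank_range hc ht htl hne hf hns (hx.subst_linearCombination f) hT r
    have h3 := LinearMap.finrank_range_add_finrank_ker (T - r • LinearMap.id)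
    rw [← hDdef] at h3 hr
    generalize finrank F (LinearMap.range (T - r • LinearMap.id)) = s at *
    generalize finrank F (LinearMap.ker (T - r • LinearMap.id)) = ν at *
    -- With s + ν = D the main term s² + ν² equals D² - 2sν, and s ≥ 152, 4ν > D give 2sν > 76D. The
    -- linear terms of `subspaceExp` return 6D, whence the 70D of the hypothesis.
    have hs : 152 ≤ s := by omega
    have e1 : 4 * subspaceExp s ≤ s * s + 6 * s + 1 := Nat.mul_div_le _ _
    have e2 : 4 * subspaceExp ν ≤ ν * ν + 6 * ν + 1 := Nat.mul_div_le _ _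
    have e3 : 152 * ν ≤ s * ν := Nat.mul_le_mul_right _ hs
    have e4 : D * D = s * s + 2 * (s * ν) + ν * ν := by rw [← h3]; ring
    omega

end Estimates

/-! ### Comparison of the counts and the limit -/

section Main

open Module

universe u

variable {F : Type u} [Field F] [Finite F] {V : Set (FreeNonUnitalNonAssocAlgebra F ℕ)} {c n : ℕ}

theorem card_end {F : Type*} [Field F] (n : ℕ) : Nat.card ((Fin n → F) →ₗ[F] (Fin n → F)) = Nat.card F ^ (n * n) := by
  rw [Module.natCard_eq_pow_finrank (K := F), finrank_linearMap, finrank_fin_fun]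

/-- There are many isomorphism classes. -/
theorem card_submodule_le_card_isoClasses (hnil : IsStepNilpotent V c)
    (hx : IsFreeCentral F c (gen V n)) :
    Nat.card (Submodule F (power F (RelFree V n) c)) ≤
      Nat.card (IsoClasses V n) * Nat.card F ^ (n * n) := by
  have := finite_isoClasses (n := n) hnil
  set C := power F (RelFree V n) c with hC
  have hid : ∀ S : Submodule F C, IsIdeal (S.map C.subtype) := by
    rintro S a _ ⟨y, hy, rfl⟩
    obtain ⟨h1, h2⟩ := mul_eq_zero_of_mem_power hx.power_succ_eq_bot y.2 a
    refine ⟨?_, ?_⟩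
    · rw [Submodule.subtype_apply, h2]; exact zero_mem _
    · rw [Submodule.subtype_apply, h1]; exact zero_mem _
  let cl : Submodule F C → IsoClasses V n := fun S => idealClass (hid S)
  -- Fix one subspace in each class; then S is recovered from its class and the substitution
  -- carrying S to that representative.
  have hcl : ∀ S, cl (Function.invFun cl (cl S)) = cl S := fun S => Function.invFun_eq ⟨S, rfl⟩
  choose f hf using fun S => exists_subst_of_idealClass_eq hx (hid S)
    (hid (Function.invFun cl (cl S))) (hcl S).symm
  have : Finite ((Fin n → F) →ₗ[F] (Fin n → F)) := Module.finite_of_finite F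
  rw [← card_end, ← Nat.card_prod]
  refine Nat.card_le_card_of_injective (fun S => (cl S, f S)) ?_
  intro S S' h
  obtain ⟨h1, h2⟩ := Prod.ext_iff.mp h
  refine Submodule.map_injective_of_injective C.injective_subtype ?_
  have hmem : ∀ S : Submodule F C, ∀ y ∈ S.map C.subtype, y ∈ C := fun S y hy =>
    Submodule.map_subtype_le C S hy
  ext y
  by_cases hy : y ∈ C
  · change cl S = cl S' at h1
    change f S = f S' at h2
    rw [hf S y hy, hf S' y hy, h1, h2]
  · exact ⟨fun h => absurd (hmem _ y h) hy, fun h => absurd (hmem _ y h) hy⟩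

/-- A class is determined by any ideal presenting it, so one exceptional ideal is chosen per class
and a union bound over the substitutions is applied. -/
theorem card_nonScalarClasses_le (hc : 2 ≤ c) (hnil : IsStepNilpotent V c)
    (hx : IsFreeCentral F c (gen V n)) {a b : ℕ}
    (ha : {K : Submodule F (RelFree V n) | IsIdeal K ∧ ¬ K ≤ power F (RelFree V n) c}.ncard ≤ a)
    (hb : ∀ f : (Fin n → F) →ₗ[F] (Fin n → F), Function.Surjective f → (¬ ∃ r : F, f = r • 1) →
      {K : Submodule F (RelFree V n) | K ≤ power F (RelFree V n) c ∧
        ∀ k ∈ K, hx.subst f k ∈ K}.ncard ≤ b) :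
    Nat.card (nonScalarClasses V n) ≤ a + Nat.card F ^ (n * n) * b := by
  classical
  have := finite_relFree n hnil
  have : Finite ((Fin n → F) →ₗ[F] (Fin n → F)) := Module.finite_of_finite F
  have := Fintype.ofFinite ((Fin n → F) →ₗ[F] (Fin n → F))
  set B₁ : Set (Submodule F (RelFree V n)) :=
    {K | IsIdeal K ∧ ¬ K ≤ power F (RelFree V n) c}
  let B₂ : ((Fin n → F) →ₗ[F] (Fin n → F)) → Set (Submodule F (RelFree V n)) := fun f =>
    if Function.Surjective f ∧ ¬ ∃ r : F, f = r • 1 then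
      {K | K ≤ power F (RelFree V n) c ∧ ∀ k ∈ K, hx.subst f k ∈ K} else ∅
  have hB₂ : ∀ f, (B₂ f).ncard ≤ b := by
    intro f
    simp only [B₂]
    split_ifs with h
    · exact hb f h.1 h.2
    · simp
  choose K hK hKz hKb using fun z : nonScalarClasses V n =>
    exists_of_mem_nonScalarClasses hc hnil hx z.2
  have hmem : ∀ z, K z ∈ B₁ ∪ ⋃ f ∈ (Finset.univ : Finset ((Fin n → F) →ₗ[F] (Fin n → F))),
      B₂ f := by
    intro z
    rcases hKb z with h | ⟨h1, f, h2, h3, h4⟩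
    · exact Or.inl ⟨hK z, h⟩
    · refine Or.inr ?_
      simp only [Finset.mem_univ, Set.iUnion_true, Set.mem_iUnion]
      refine ⟨f, ?_⟩
      simp only [B₂]
      rw [if_pos ⟨h2, h3⟩]
      exact ⟨h1, h4⟩
  have hcl : ∀ {K K' : Submodule F (RelFree V n)} (h : IsIdeal K) (h' : IsIdeal K'), K = K' →
      idealClass h = idealClass h' := by
    rintro K _ h h' rfl
    rfl
  calc Nat.card (nonScalarClasses V n) ≤ Nat.card ↥(B₁ ∪
        ⋃ f ∈ (Finset.univ : Finset ((Fin n → F) →ₗ[F] (Fin n → F))), B₂ f) := by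
        refine Nat.card_le_card_of_injective (fun z => ⟨K z, hmem z⟩) ?_
        intro z z' h
        apply Subtype.ext
        rw [← hKz z, ← hKz z']
        exact hcl _ _ (congrArg Subtype.val h)
    _ = (B₁ ∪ ⋃ f ∈ (Finset.univ : Finset ((Fin n → F) →ₗ[F] (Fin n → F))), B₂ f).ncard :=
      Nat.card_coe_set_eq _
    _ ≤ B₁.ncard + (⋃ f ∈ (Finset.univ : Finset ((Fin n → F) →ₗ[F] (Fin n → F))), B₂ f).ncard :=
      Set.ncard_union_le _ _
    _ ≤ a + ∑ f : (Fin n → F) →ₗ[F] (Fin n → F), b :=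
      Nat.add_le_add ha ((Finset.set_ncard_biUnion_le _ _).trans
        (Finset.sum_le_sum fun f _ => hB₂ f))
    _ = _ := by
      rw [Finset.sum_const, smul_eq_mul, Finset.card_univ, ← Nat.card_eq_fintype_card, card_end]

/-- The quantitative form of the theorem. -/
theorem card_nonScalarClasses_mul_lt (hc : 2 ≤ c) (hnil : IsStepNilpotent V c)
    (hcentral : IsCentral V c) (hn : 83 * c ≤ n) :
    Nat.card (nonScalarClasses V n) * 2 ^ n < Nat.card (IsoClasses V n) := by
  have hx := isFreeCentral_relFree n hnil hcentral (by omega)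
  have := finite_relFree n hnil
  obtain ⟨t, ht, htl, hne⟩ := exists_nonzero_monomial hnil
  have hDn := hx.choose_le_finrank (by omega) ht htl (hne n)
  have h2 : n * (n - 1) ≤ 2 * finrank F (power F (RelFree V n) c) := by
    have h := (choose_two_le_choose hc (by omega)).trans hDn
    have h3 : n * (n - 1) / 2 ≤ finrank F (power F (RelFree V n) c) := by
      rwa [← Nat.choose_two_right]
    have h4 : n * (n - 1) / 2 * 2 = n * (n - 1) := Nat.div_two_mul_two_of_even
      (Nat.even_mul_pred_self n)
    omega
  have hI := card_submodule_le_card_isoClasses hnil hx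
  have hG := pow_le_card_submodule (F := F) (X := power F (RelFree V n) c)
  set D := finrank F (power F (RelFree V n) c) with hD
  set q := Nat.card F with hq
  have hq2 : 2 ≤ q := two_le_card_field F
  have hn166 : 166 ≤ n := by omega
  obtain ⟨m, rfl⟩ := Nat.exists_eq_add_of_le' (show 1 ≤ n by omega)
  rw [Nat.add_sub_cancel] at h2
  set G := (D / 2) * (D - D / 2) with hGdef
  have h4G : D * D ≤ 4 * G + 1 := by
    rcases Nat.even_or_odd' D with ⟨k, hk | hk⟩
    · have h1 : D / 2 = k := by omega
      have h3 : D - D / 2 = k := by omega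
      rw [hGdef, h3, h1, hk]; nlinarith
    · have h1 : D / 2 = k := by omega
      have h3 : D - D / 2 = k + 1 := by omega
      rw [hGdef, h3, h1, hk]; nlinarith
  set N2 := (m + 1) * (m + 1) with hN2
  have hN2D : N2 + (m + 1) ≤ 3 * D := by nlinarith
  have hmD : 80 * (m + 1) ≤ D := by nlinarith
  have hD1000 : 1000 ≤ D := by omega
  have hGD : 12 * D ≤ G := by nlinarith
  -- Both exponents are chosen so that each exceptional kind, after the factor q^(n²) for the
  -- second, contributes q^(G - n² - n - 2). The bounds n² + n ≤ 3D and 12D ≤ G keep the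
  -- subtractions genuine.
  have ha := ncard_ideals_not_le hx (by omega) hn (by omega) (e := G - N2 - (m + 1) - 2)
    (by rw [← hD]; omega)
  have hb := fun f hf hns => ncard_subst_invariant_le hx hc ht htl (hne (m + 1)) hn
    (by omega) (f := f) hf hns (e := G - 2 * N2 - (m + 1) - 2) (by rw [← hD]; omega)
  have hN := card_nonScalarClasses_le hc hnil hx ha hb
  rw [← hq, ← hN2, ← pow_add] at hN
  have hsum : q ^ (G - N2 - (m + 1) - 2) + q ^ (N2 + (G - 2 * N2 - (m + 1) - 2)) ≤
      q ^ (G - N2 - (m + 1) - 1) := by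
    have e1 : N2 + (G - 2 * N2 - (m + 1) - 2) = G - N2 - (m + 1) - 2 := by omega
    have e2 : G - N2 - (m + 1) - 1 = (G - N2 - (m + 1) - 2) + 1 := by omega
    rw [e1, e2, pow_succ, ← two_mul, mul_comm]
    exact Nat.mul_le_mul_left _ hq2
  have hlt : Nat.card (nonScalarClasses V (m + 1)) * 2 ^ (m + 1) * q ^ N2 <
      Nat.card (IsoClasses V (m + 1)) * q ^ N2 :=
    calc Nat.card (nonScalarClasses V (m + 1)) * 2 ^ (m + 1) * q ^ N2
        ≤ q ^ (G - N2 - (m + 1) - 1) * q ^ (m + 1) * q ^ N2 :=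
          Nat.mul_le_mul_right _ (Nat.mul_le_mul (hN.trans hsum) (Nat.pow_le_pow_left hq2 _))
      _ = q ^ (G - 1) := by
        rw [← pow_add, ← pow_add]
        congr 1
        omega
      _ < q ^ G := Nat.pow_lt_pow_right (by omega) (by omega)
      _ ≤ _ := hG.trans hI
  exact Nat.lt_of_mul_lt_mul_right hlt

theorem scalarClasses_eq_compl {F : Type u} [Field F] (V : Set (FreeNonUnitalNonAssocAlgebra F ℕ)) (n : ℕ) :
    scalarClasses V n = (nonScalarClasses V n)ᶜ := by
  ext z
  constructor
  · rintro h ⟨A, hA, δ, hδ, hns⟩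
    exact hns (h A hA δ hδ)
  · intro h A hA δ hδ
    by_contra hns
    exact h ⟨A, hA, δ, hδ, hns⟩

theorem one_sub_lt_card_div (hc : 2 ≤ c) (hnil : IsStepNilpotent V c)
    (hcentral : IsCentral V c) (hn : 83 * c ≤ n) :
    1 - (1 / 2 : ℝ) ^ n < (Nat.card ((nonScalarClasses V n)ᶜ : Set (IsoClasses V n)) : ℝ) /
      (Nat.card (IsoClasses V n) : ℝ) := by
  have := finite_isoClasses (n := n) hnil
  have h := card_nonScalarClasses_mul_lt hc hnil hcentral hn
  have hadd : Nat.card (nonScalarClasses V n) +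
      Nat.card ((nonScalarClasses V n)ᶜ : Set (IsoClasses V n)) = Nat.card (IsoClasses V n) := by
    rw [Nat.card_coe_set_eq, Nat.card_coe_set_eq]
    exact Set.ncard_add_ncard_compl _
  set N := Nat.card (nonScalarClasses V n)
  set T := Nat.card ((nonScalarClasses V n)ᶜ : Set (IsoClasses V n))
  set I := Nat.card (IsoClasses V n)
  have hI : (0 : ℝ) < I := by exact_mod_cast (Nat.zero_le _).trans_lt h
  rw [lt_div_iff₀ hI, one_div, inv_pow]
  have h1 : (N : ℝ) * 2 ^ n < I := by exact_mod_cast h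
  have h2 : (N : ℝ) + T = I := by exact_mod_cast hadd
  have h3 : (N : ℝ) < I * ((2 : ℝ) ^ n)⁻¹ := by
    rw [← div_eq_mul_inv, lt_div_iff₀ (by positivity)]
    exact h1
  linarith

theorem tendsto_card_div (hc : 2 ≤ c) (hnil : IsStepNilpotent V c) (hcentral : IsCentral V c) :
    Tendsto (fun n => (Nat.card ((nonScalarClasses V n)ᶜ : Set (IsoClasses V n)) : ℝ) /
      (Nat.card (IsoClasses V n) : ℝ)) atTop (𝓝 1) := by
  have h1 : Tendsto (fun n : ℕ => 1 - (1 / 2 : ℝ) ^ n) atTop (𝓝 1) := by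
    have := (tendsto_pow_atTop_nhds_zero_of_lt_one (r := (1 / 2 : ℝ)) (by norm_num)
      (by norm_num)).const_sub 1
    simpa using this
  refine tendsto_of_tendsto_of_tendsto_of_le_of_le' h1 tendsto_const_nhds ?_ ?_
  · filter_upwards [eventually_ge_atTop (83 * c)] with n hn
    exact (one_sub_lt_card_div hc hnil hcentral hn).le
  · refine Eventually.of_forall fun n => ?_
    have := finite_isoClasses (n := n) hnil
    refine div_le_one_of_le₀ ?_ (Nat.cast_nonneg _)
    exact_mod_cast Nat.card_le_card_of_injective Subtype.val Subtype.val_injective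

end Main

end NilpAlg

theorem mainTheorem10 {F : Type*} [Field F] [Finite F] (c : ℕ) (hc : 2 ≤ c)
    (V : Set (FreeNonUnitalNonAssocAlgebra F ℕ))
    (hnil : NilpAlg.IsStepNilpotent V c) (hcentral : NilpAlg.IsCentral V c) :
    NilpAlg.IsGeneric (NilpAlg.IsoClasses V) (NilpAlg.scalarClasses V) ∧
      NilpAlg.IsExpNegligible (NilpAlg.IsoClasses V) (NilpAlg.nonScalarClasses V) := by
  have hfin : ∀ n, Finite (NilpAlg.IsoClasses V n) := fun n => NilpAlg.finite_isoClasses hnil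
  refine ⟨⟨hfin, ?_⟩, hfin, 1 / 2, by norm_num, by norm_num, ?_⟩
  · simp only [NilpAlg.scalarClasses_eq_compl]
    exact NilpAlg.tendsto_card_div hc hnil hcentral
  · filter_upwards [eventually_ge_atTop (83 * c)] with n hn
    exact NilpAlg.one_sub_lt_card_div hc hnil hcentral hn
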